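/- **Setting.** Let $K$ be a field of characteristic $0$, with parameters $g_e, r_e\in K$ for the elements $e$ (in particular they may be indeterminates). A *ground set orientation* $\epsilon$ is an alternating function on finite sequences of elements with values in $\{0,\pm1\}$, non-zero on sequences of distinct elements, and with $\epsilon(\emptyset)=1$. Set symbols such as $P,E$ also denote sequences listing the set, and juxtaposition is concatenation. An *extensor* with finite ground set $S$ is a decomposable element $\mathbf N=c\,\mathbf v_1\cdots\mathbf v_r$ of the exterior algebra of the vector space with basis $S$; its Plücker coordinate $\mathbf N[A]$ is its alternating coefficient at the sequence $A$. Its dual is given by $\mathbf N^{\perp}[X]=\mathbf N[S\setminus X]\,\epsilon((S\setminus X)\,X)$ and its contraction by $(\mathbf N/A)[X]=\mathbf N[XA]$. For $S=P\sqcup E$ ($P$ the ports) let $P_\iota,P_\upsilon$ be two disjoint copies of $P$, let $\iota_g$ and $\upsilon_r$ be the exterior algebra maps with $\iota_g(\mathbf p)=\mathbf p_\iota$, $\upsilon_r(\mathbf p)=\mathbf p_\upsilon$ for $p\in P$ and $\iota_g(\mathbf e)=g_e\mathbf e$, $\upsilon_r(\mathbf e)=r_e\mathbf e$ for $e\in E$,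 and put $$\mathbf M_E(\mathbf N)=\bigl(\iota_g(\mathbf N)\,\upsilon_r(\mathbf N^{\perp})\bigr)/E .$$ A non-zero extensor $\mathbf N=c\,\mathbf v_1\cdots\mathbf v_r$ over $\mathbb Q$ with ground set $S$ *presents* the oriented matroid on $S$ whose covectors are the sign vectors of the members of $\mathrm{span}(v_1,\dots,v_r)$; it is *unimodular* if all its Plücker coordinates are $0,\pm1$. An oriented matroid $\mathcal N$ is *unimodular* (regular) if it has a unimodular presentation. A ported oriented matroid $\mathcal N=\mathcal N(P,E)$ is one whose ground set is written as $P\sqcup E$. **Theorem.** Every unimodular oriented matroid has exactly two unimodular presentations $\pm\mathbf N$, and $\mathbf M_E(\mathcal N):=\mathbf M_E(\pm\mathbf N)$ is a well-defined function on the ported unimodular oriented matroids $\mathcal N=\mathcal N(P,E)$, whose value is a (possibly zero) extensor with ground set $P_\iota\sqcup P_\upsilon$. The class of unimodular oriented matroids is closed under minors and direct sums, and: 1. If $e\in E$ is neither a loop nor a coloop of $\mathcal N=\mathcal N(P,E)$ and $E'$ is any sequence of the elements of $E\setminus\{e\}$, then $$\mathbf M_E(\mathcal N)=\epsilon(PE)\,\epsilon(PE')\,\bigl(g_e\,\mathbf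 M_{E'}(\mathcal N/e)+r_e\,\mathbf M_{E'}(\mathcal N\setminus e)\bigr).$$ 2. If $\mathcal N_1(P_1,E_1)$ and $\mathcal N_2(P_2,E_2)$ have disjoint ground sets, and $E$ is any sequence of the elements of $E_1\sqcup E_2$, then $$\mathbf M_E(\mathcal N_1\oplus\mathcal N_2)=\epsilon(P_1P_2E)\,\epsilon(P_1E_1)\,\epsilon(P_2E_2)\;\mathbf M_{E_1}(\mathcal N_1)\,\mathbf M_{E_2}(\mathcal N_2),$$ the port set of $\mathcal N_1\oplus\mathcal N_2$ being $P_1\sqcup P_2$. 3. If $P=\emptyset$ and $\mathcal B(\mathcal N)$ is the collection of bases of $\mathcal N$, then $$\mathbf M_E(\mathcal N)=\epsilon(E)\sum_{B\in\mathcal B(\mathcal N)}\ \prod_{e\in B}g_e\prod_{e\in E\setminus B}r_e .$$ -/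

import Mathlib

noncomputable section

namespace PortedTutte

/-! ### Exterior algebra on a ground set, extensors and Plücker coordinates

All ground sets are finite subsets `S` of one type `α` of elements.  The exterior algebra of
`F S` is the subalgebra of the exterior algebra of `α →₀ F` generated by the vectors supported
on `S`.  Sequences of elements are lists. -/

/-- The exterior algebra over the vector space with basis `α`. -/
abbrev Ext (F α : Type*) [Field F] : Type _ := ExteriorAlgebra F (α →₀ F)

section Exterior

variable {F α : Type*} [Field F]

/-- The image in the exterior algebra of the basis vector `a`. -/
def vec (F : Type*) {α : Type*} [Field F] (a : α) : Ext F α :=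
  ExteriorAlgebra.ι F (Finsupp.single a 1)

/-- The product `𝐀 = 𝐚₁ ⋯ 𝐚ₖ` of the basis vectors in the sequence `A = a₁ ⋯ aₖ`. -/
def mono (F : Type*) {α : Type*} [Field F] (A : List α) : Ext F α :=
  (A.map (vec F)).prod

/-- The alternating form `(v₁, …, vₖ) ↦ det (vᵢ(aⱼ))` attached to `A = a₁ ⋯ aₖ`. -/
def minorForm (F : Type*) {α : Type*} [Field F] (A : List α) :
    (α →₀ F) [⋀^Fin A.length]→ₗ[F] F :=
  (Matrix.detRowAlternating (n := Fin A.length) (R := F)).compLinearMap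
    (LinearMap.pi fun j => Finsupp.lapply (A.get j))

/-- The coefficient (Plücker coordinate) `N[A]` of `N` at the sequence `A`, as a linear
functional of `N`: on a product of `k` vectors, `k` the length of `A`, it is the minor
`det (vᵢ(aⱼ))`, and it is `0` on products of any other number of vectors. -/
def coord (N : Ext F α) (A : List α) : F :=
  ExteriorAlgebra.liftAlternating
    (Function.update (fun _ => 0) A.length (minorForm F A)) N

/-- `N = c 𝐯₁ ⋯ 𝐯ᵣ` with all the vectors `vᵢ` supported on `S`. -/
def IsFactorization (S : Finset α) (N : Ext F α) (c : F) (vs : List (α →₀ F)) : Prop :=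
  (∀ v ∈ vs, ∀ a ∉ S, v a = 0) ∧ N = c • (vs.map (ExteriorAlgebra.ι F)).prod

/-- `N` is an extensor (a decomposable element, possibly zero) with ground set `S`. -/
def IsExtensor (S : Finset α) (N : Ext F α) : Prop :=
  ∃ c vs, IsFactorization S N c vs

/-- Contraction `N / e`: interior multiplication on the right by the coordinate functional
of `e`, so that `(N / e)[B] = N[Be]`. -/
def contract (N : Ext F α) (e : α) : Ext F α :=
  CliffordAlgebra.contractRight (Q := (0 : QuadraticForm F (α →₀ F))) N (Finsupp.lapply e)

/-- `N / A = N / aₖ / ⋯ / a₁` for `A = a₁ ⋯ aₖ`, so that `(N / A)[X] = N[XA]`. -/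
def contractList (N : Ext F α) (A : List α) : Ext F α :=
  A.foldr (fun a M => contract M a) N

/-- On a product of as many vectors as `A` has elements, `coord` is the minor at `A`. -/
theorem coord_prod {n : ℕ} (v : Fin n → α →₀ F) (A : List α) (h : n = A.length) :
    coord (ExteriorAlgebra.ιMulti F n v) A =
      Matrix.det (Matrix.of fun i j : Fin n => v i (A.get (j.cast h))) := by
  subst h
  rw [coord, ExteriorAlgebra.liftAlternating_apply_ιMulti, Function.update_self]
  rfl

theorem coord_prod_ne {n : ℕ} (v : Fin n → α →₀ F) (A : List α) (h : n ≠ A.length) :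
    coord (ExteriorAlgebra.ιMulti F n v) A = 0 := by
  rw [coord, ExteriorAlgebra.liftAlternating_apply_ιMulti, Function.update_of_ne h]
  rfl

theorem contract_vec_mul (e : α) (a : α →₀ F) (x : Ext F α) :
    contract (ExteriorAlgebra.ι F a * x) e =
      ExteriorAlgebra.ι F a * contract x e + a e • CliffordAlgebra.involute x := by
  induction x using CliffordAlgebra.right_induction with
  | algebraMap r =>
    have h1 : ExteriorAlgebra.ι F a * algebraMap F (Ext F α) r = r • ExteriorAlgebra.ι F a := by
      rw [Algebra.smul_def, Algebra.commutes]
    have h2 := CliffordAlgebra.contractRight_ι (Q := (0 : QuadraticForm F (α →₀ F))) (Finsupp.lapply e) a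
    have h3 := CliffordAlgebra.contractRight_algebraMap (Q := (0 : QuadraticForm F (α →₀ F))) (Finsupp.lapply e) r
    simp only [contract]
    erw [h1, h3, map_smul, LinearMap.smul_apply, h2]
    simp only [Algebra.smul_def, mul_zero, zero_add, Finsupp.lapply_apply, AlgHom.commutes]
    exact Algebra.commutes _ _
  | add x y hx hy =>
    simp only [contract, mul_add, map_add, LinearMap.add_apply, smul_add] at *
    rw [hx, hy]; abel
  | mul_ι b y hy =>
    simp only [contract] at *
    have h1 := CliffordAlgebra.contractRight_mul_ι (Q := (0 : QuadraticForm F (α →₀ F))) (Finsupp.lapply e)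
    rw [← mul_assoc, h1, hy, h1]
    rw [map_mul, CliffordAlgebra.involute_ι, mul_sub, mul_smul_comm, add_mul, smul_mul_assoc,
      mul_neg, smul_neg, mul_assoc (ExteriorAlgebra.ι F a) (_ : CliffordAlgebra _) (_)]
    have key : ∀ p q t : Ext F α, p - (q + t) = p - q + -t := fun p q t => by abel
    exact key _ _ _

theorem contract_prod (e : α) (n : ℕ) (v : Fin (n + 1) → α →₀ F) :
    contract (ExteriorAlgebra.ιMulti F (n + 1) v) e =
      ∑ i : Fin (n + 1), ((-1) ^ (i + n : ℕ) * v i e) •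
        ExteriorAlgebra.ιMulti F n (v ∘ i.succAbove) := by
  induction n with
  | zero =>
    rw [ExteriorAlgebra.ιMulti_succ_apply, contract_vec_mul]
    simp [contract, CliffordAlgebra.contractRight_one]
  | succ n ih =>
    have hinv : ∀ (m : ℕ) (w : Fin m → α →₀ F), CliffordAlgebra.involute
        (ExteriorAlgebra.ιMulti F m w) = (-1 : F) ^ m • ExteriorAlgebra.ιMulti F m w := by
      intro m w
      have := CliffordAlgebra.involute_prod_map_ι (Q := (0 : QuadraticForm F (α →₀ F)))
        (List.ofFn w)
      rw [List.map_ofFn, List.length_ofFn] at this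
      rw [ExteriorAlgebra.ιMulti_apply]
      exact this
    rw [ExteriorAlgebra.ιMulti_succ_apply, contract_vec_mul, hinv, ih, Finset.mul_sum,
      Fin.sum_univ_succ (n := n + 1), add_comm]
    congr 1
    · rw [smul_smul]
      simp [Matrix.vecTail, Function.comp_def, mul_comm]
    · refine Finset.sum_congr rfl fun i _ => ?_
      rw [ExteriorAlgebra.ιMulti_succ_apply, mul_smul_comm]
      congr 1
      · simp only [Matrix.vecTail, Function.comp, Fin.val_succ]
        congr 1
        rw [show (i : ℕ) + 1 + (n + 1) = i + n + 2 by ring, pow_add _ _ 2]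
        simp
      · congr 2
        funext j
        simp [Matrix.vecTail]

/-- The Plücker coordinates of a contraction: `(N / e)[B] = N[Be]`. -/
theorem coord_contract (N : Ext F α) (e : α) (B : List α) :
    coord (contract N e) B = coord N (B ++ [e]) := by
  have hl : (B ++ [e]).length = B.length + 1 := by simp
  let f : Ext F α →ₗ[F] F := (ExteriorAlgebra.liftAlternating
    (Function.update (fun _ => 0) B.length (minorForm F B))).comp
      ((CliffordAlgebra.contractRight (Q := (0 : QuadraticForm F (α →₀ F)))).flip
        (Finsupp.lapply e))
  let f' : Ext F α →ₗ[F] F := ExteriorAlgebra.liftAlternating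
    (Function.update (fun _ => 0) (B ++ [e]).length (minorForm F (B ++ [e])))
  suffices f = f' from congrArg (fun h => h N) this
  refine ExteriorAlgebra.lhom_ext fun n => AlternatingMap.ext fun v => ?_
  change coord (contract (ExteriorAlgebra.ιMulti F n v) e) B
    = coord (ExteriorAlgebra.ιMulti F n v) (B ++ [e])
  cases n with
  | zero =>
    rw [coord_prod_ne _ _ (by simp)]
    simp [contract, coord, CliffordAlgebra.contractRight_one]
  | succ n =>
    have hlin : ∀ (g : Fin (n + 1) → F) (X : Fin (n + 1) → Ext F α),
        coord (∑ i, g i • X i) B = ∑ i, g i * coord (X i) B := by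
      intro g X; simp [coord]
    rw [contract_prod, hlin]
    by_cases h : n = B.length
    · subst h
      rw [coord_prod _ _ hl.symm, Matrix.det_succ_column _ (Fin.last _)]
      refine Finset.sum_congr rfl fun i _ => ?_
      rw [coord_prod _ _ rfl]
      congr 1
      · simp
      · congr 1
        ext a b
        simp
    · rw [coord_prod_ne _ _ (by simpa using h)]
      exact Finset.sum_eq_zero fun i _ => by rw [coord_prod_ne _ _ h, mul_zero]

end Exterior

/-! ### Ground set orientations and the canonical dual -/

/-- A ground set orientation: an alternating function on sequences, with values `0, ±1`,
that is nonzero on sequences of distinct elements and is `1` on the empty sequence. -/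
structure GroundSetOrientation (α : Type*) where
  sgn : List α → ℤ
  values : ∀ A, sgn A = 0 ∨ sgn A = 1 ∨ sgn A = -1
  alternating : ∀ (n : ℕ) (x : Fin n → α) (σ : Equiv.Perm (Fin n)),
    sgn (List.ofFn (x ∘ σ)) = (Equiv.Perm.sign σ : ℤ) * sgn (List.ofFn x)
  ne_zero : ∀ A : List α, A.Nodup → sgn A ≠ 0
  nil : sgn [] = 1

section Dual

variable {F α : Type*} [Field F] [DecidableEq α]

/-- The canonical dual of an extensor `N` with ground set `S`:
`N^⊥[X] = N[S ∖ X] ε((S ∖ X) X)` for `X ⊆ S`.  Every summand is independent of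
the order in which the elements of `X` and of `S ∖ X` are listed. -/
def dual (ε : GroundSetOrientation α) (S : Finset α) (N : Ext F α) : Ext F α :=
  ∑ X ∈ S.powerset,
    (coord N (S \ X).toList * (ε.sgn ((S \ X).toList ++ X.toList) : F)) • mono F X.toList

end Dual

/-! ### The extensor function `M_E(N)` -/

/-- The elements of `E` together with two disjoint copies `P_ι`, `P_υ` of the ports. -/
inductive PortedElt (α : Type*) where
  | elem (e : α)
  | iota (p : α)
  | upsilon (p : α)
  deriving DecidableEq

section ExtensorFunction

variable {F K α : Type*} [Field F] [Field K] [Algebra F K] [DecidableEq α]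

/-- The algebra map from the exterior algebra over `F` to the exterior algebra over the
extension `K` of `F` that sends the vector of a port `p ∈ P` to that of its copy `copy p`, and
the vector of a non-port `e` to `w e` times that of `e`. -/
def substHom (F : Type*) {K α : Type*} [Field F] [Field K] [Algebra F K] [DecidableEq α]
    (copy : α → PortedElt α) (w : α → K) (P : List α) : Ext F α →ₐ[F] Ext K (PortedElt α) :=
  ExteriorAlgebra.lift F
    ⟨((ExteriorAlgebra.ι K (M := PortedElt α →₀ K)).restrictScalars F).comp
      (Finsupp.linearCombination F fun a : α =>
        if a ∈ P then Finsupp.single (copy a) (1 : K) else Finsupp.single (.elem a) (w a)),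
      fun _ => ExteriorAlgebra.ι_sq_zero _⟩

/-- `M(N) = ι_g(N) υ_r(N^⊥)` for an extensor `N = N(P, E)`. -/
def extM (ε : GroundSetOrientation α) (g r : α → K) (P E : List α) (N : Ext F α) :
    Ext K (PortedElt α) :=
  substHom F .iota g P N * substHom F .upsilon r P (dual ε (P ++ E).toFinset N)

/-- `M_E(N) = M(N) / E`. -/
def extME (ε : GroundSetOrientation α) (g r : α → K) (P E : List α) (N : Ext F α) :
    Ext K (PortedElt α) :=
  contractList (extM ε g r P E N) (E.map .elem)

end ExtensorFunction

/-! ### Oriented matroids -/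

/-- The composition `X ∘ Y` of sign vectors. -/
def comp {α : Type*} (X Y : α → SignType) : α → SignType :=
  fun a => if X a = 0 then Y a else X a

/-- An oriented matroid on a finite ground set, given by its covectors (extended by `0`
outside of the ground set). -/
@[ext]
structure OrientedMatroid (α : Type*) where
  ground : Finset α
  covectors : Set (α → SignType)
  support : ∀ X ∈ covectors, ∀ a ∉ ground, X a = 0
  zero_mem : 0 ∈ covectors
  neg_mem : ∀ X ∈ covectors, -X ∈ covectors
  comp_mem : ∀ X ∈ covectors, ∀ Y ∈ covectors, comp X Y ∈ covectors
  elim : ∀ X ∈ covectors, ∀ Y ∈ covectors, ∀ e, X e ≠ 0 → X e = -Y e →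
    ∃ Z ∈ covectors, Z e = 0 ∧ ∀ f, ¬ (X f ≠ 0 ∧ X f = -Y f) → Z f = comp X Y f

namespace OrientedMatroid

variable {α : Type*} [DecidableEq α]

/-- `e` is a loop: every covector vanishes at `e`. -/
def IsLoop (M : OrientedMatroid α) (e : α) : Prop :=
  e ∈ M.ground ∧ ∀ X ∈ M.covectors, X e = 0

/-- `e` is a coloop: some covector has support `{e}`. -/
def IsColoop (M : OrientedMatroid α) (e : α) : Prop :=
  e ∈ M.ground ∧ ∃ X ∈ M.covectors, ∀ a, X a ≠ 0 ↔ a = e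

/-- A separator is an element that is a loop or a coloop. -/
def IsSeparator (M : OrientedMatroid α) (e : α) : Prop :=
  M.IsLoop e ∨ M.IsColoop e

/-- A set of elements is spanning iff it meets the support of every nonzero covector (that is,
of every cocircuit). -/
def IsSpanning (M : OrientedMatroid α) (B : Finset α) : Prop :=
  B ⊆ M.ground ∧ ∀ X ∈ M.covectors, (∀ b ∈ B, X b = 0) → X = 0

/-- Bases are the minimal spanning sets. -/
def IsBase (M : OrientedMatroid α) (B : Finset α) : Prop :=
  Minimal M.IsSpanning B

/-- The finite collection of the bases. -/
def bases (M : OrientedMatroid α) : Finset (Finset α) := by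
  classical exact M.ground.powerset.filter M.IsBase

/-- The deletion `M ∖ e`: its covectors are the restrictions of the covectors of `M`. -/
def delete (M : OrientedMatroid α) (e : α) : OrientedMatroid α where
  ground := M.ground.erase e
  covectors := {X | ∃ Y ∈ M.covectors, X = Function.update Y e 0}
  support := by
    rintro _ ⟨Y, hY, rfl⟩ a ha
    by_cases h : a = e
    · simp [h]
    · simpa [h] using M.support Y hY a (by simpa [h] using ha)
  zero_mem := ⟨0, M.zero_mem, by simp⟩
  neg_mem := by
    rintro _ ⟨Y, hY, rfl⟩
    refine ⟨-Y, M.neg_mem Y hY, ?_⟩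
    ext1 a
    by_cases h : a = e <;> simp [h]
  comp_mem := by
    rintro _ ⟨Y, hY, rfl⟩ _ ⟨Z, hZ, rfl⟩
    refine ⟨comp Y Z, M.comp_mem Y hY Z hZ, ?_⟩
    ext1 a
    by_cases h : a = e <;> simp [h, comp]
  elim := by
    rintro _ ⟨Y, hY, rfl⟩ _ ⟨Z, hZ, rfl⟩ f hf hs
    have hfe : f ≠ e := by rintro rfl; simp at hf
    obtain ⟨W, hW, h0, h1⟩ := M.elim Y hY Z hZ f (by simpa [hfe] using hf)
      (by simpa [hfe] using hs)
    refine ⟨_, ⟨W, hW, rfl⟩, by simpa [hfe] using h0, fun a ha => ?_⟩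
    by_cases h : a = e
    · simp [h, comp]
    · simpa [h, comp] using h1 a (by simpa [h] using ha)

/-- The contraction `M / e`: its covectors are the covectors of `M` that vanish at `e`. -/
def contract (M : OrientedMatroid α) (e : α) : OrientedMatroid α where
  ground := M.ground.erase e
  covectors := {X | X ∈ M.covectors ∧ X e = 0}
  support := by
    rintro X ⟨hX, he⟩ a ha
    by_cases h : a = e
    · simpa [h] using he
    · exact M.support X hX a (by simpa [h] using ha)
  zero_mem := ⟨M.zero_mem, rfl⟩
  neg_mem := fun X hX => ⟨M.neg_mem X hX.1, by simp [hX.2]⟩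
  comp_mem := fun X hX Y hY => ⟨M.comp_mem X hX.1 Y hY.1, by simp [comp, hX.2, hY.2]⟩
  elim := by
    rintro X hX Y hY f hf hs
    obtain ⟨W, hW, h0, h1⟩ := M.elim X hX.1 Y hY.1 f hf hs
    refine ⟨W, ⟨hW, ?_⟩, h0, h1⟩
    rw [h1 e (by simp [hX.2])]
    simp [comp, hX.2, hY.2]

/-- The direct sum of oriented matroids with disjoint ground sets: its covectors are the
unions of a covector of the one and a covector of the other. -/
def directSum (M₁ M₂ : OrientedMatroid α) (h : Disjoint M₁.ground M₂.ground) :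
    OrientedMatroid α where
  ground := M₁.ground ∪ M₂.ground
  covectors := {X | ∃ X₁ ∈ M₁.covectors, ∃ X₂ ∈ M₂.covectors, X = comp X₁ X₂}
  support := by
    rintro _ ⟨X₁, h₁, X₂, h₂, rfl⟩ a ha
    simp only [Finset.mem_union, not_or] at ha
    simp [comp, M₁.support X₁ h₁ a ha.1, M₂.support X₂ h₂ a ha.2]
  zero_mem := ⟨0, M₁.zero_mem, 0, M₂.zero_mem, by ext1 a; simp [comp]⟩
  neg_mem := by
    rintro _ ⟨X₁, h₁, X₂, h₂, rfl⟩
    refine ⟨-X₁, M₁.neg_mem X₁ h₁, -X₂, M₂.neg_mem X₂ h₂, ?_⟩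
    ext1 a
    by_cases h0 : X₁ a = 0 <;> simp [comp, h0]
  comp_mem := by
    rintro _ ⟨X₁, h₁, X₂, h₂, rfl⟩ _ ⟨Y₁, k₁, Y₂, k₂, rfl⟩
    refine ⟨_, M₁.comp_mem X₁ h₁ Y₁ k₁, _, M₂.comp_mem X₂ h₂ Y₂ k₂, ?_⟩
    ext1 a
    by_cases ha : a ∈ M₁.ground
    · have ha' := Finset.disjoint_left.1 h ha
      simp [comp, M₂.support X₂ h₂ a ha', M₂.support Y₂ k₂ a ha']
      grind
    · simp [comp, M₁.support X₁ h₁ a ha, M₁.support Y₁ k₁ a ha]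
  elim := by
    rintro _ ⟨X₁, h₁, X₂, h₂, rfl⟩ _ ⟨Y₁, k₁, Y₂, k₂, rfl⟩ e he hs
    have z₂ : ∀ a ∈ M₁.ground, X₂ a = 0 ∧ Y₂ a = 0 := fun a ha =>
      ⟨M₂.support X₂ h₂ a (Finset.disjoint_left.1 h ha),
        M₂.support Y₂ k₂ a (Finset.disjoint_left.1 h ha)⟩
    have z₁ : ∀ a ∉ M₁.ground, X₁ a = 0 ∧ Y₁ a = 0 := fun a ha =>
      ⟨M₁.support X₁ h₁ a ha, M₁.support Y₁ k₁ a ha⟩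
    by_cases hm : e ∈ M₁.ground
    · obtain ⟨hx, hy⟩ := z₂ e hm
      obtain ⟨W, hW, w0, w1⟩ := M₁.elim X₁ h₁ Y₁ k₁ e
        (by simp only [comp] at he; grind) (by simp only [comp] at hs; grind)
      have hV := M₂.comp_mem X₂ h₂ Y₂ k₂
      refine ⟨_, ⟨W, hW, _, hV, rfl⟩, by simp [comp, w0, hx, hy], fun a ha => ?_⟩
      by_cases hma : a ∈ M₁.ground
      · obtain ⟨hxa, hya⟩ := z₂ a hma
        have := w1 a (by simp only [comp] at ha; grind)
        simp only [comp] at this ⊢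
        grind
      · obtain ⟨hxa, hya⟩ := z₁ a hma
        simp [comp, hxa, hya, M₁.support W hW a hma]
    · obtain ⟨hx, hy⟩ := z₁ e hm
      obtain ⟨W, hW, w0, w1⟩ := M₂.elim X₂ h₂ Y₂ k₂ e
        (by simpa [comp, hx] using he) (by simpa [comp, hx, hy] using hs)
      have hV := M₁.comp_mem X₁ h₁ Y₁ k₁
      refine ⟨_, ⟨_, hV, W, hW, rfl⟩, by simp [comp, w0, hx, hy], fun a ha => ?_⟩
      by_cases hma : a ∈ M₁.ground
      · obtain ⟨hxa, hya⟩ := z₂ a hma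
        have := M₂.support W hW a (Finset.disjoint_left.1 h hma)
        simp only [comp]
        grind
      · obtain ⟨hxa, hya⟩ := z₁ a hma
        have := w1 a (by simp only [comp] at ha; grind)
        simp only [comp] at this ⊢
        grind

end OrientedMatroid

/-! ### Unimodular oriented matroids and `M_E(𝒩)` -/

section Unimodular

variable {α : Type*} [DecidableEq α]

/-- The nonzero extensor `N` presents the oriented matroid `M`: the covectors of `M` are the
signatures of the members of the linear subspace spanned by the vectors `v₁, …, vᵣ`, where
`N = c 𝐯₁ ⋯ 𝐯ᵣ`. -/
def Presents (N : Ext ℚ α) (M : OrientedMatroid α) : Prop :=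
  N ≠ 0 ∧ ∃ c vs, IsFactorization M.ground N c vs ∧
    M.covectors = {X | ∃ f ∈ Submodule.span ℚ {v | v ∈ vs}, X = fun a => SignType.sign (f a)}

/-- `N` is a unimodular presentation of `M`: its Plücker coordinates are all `0` or `±1`. -/
def IsUnimodularPresentation (N : Ext ℚ α) (M : OrientedMatroid α) : Prop :=
  Presents N M ∧ ∀ A : List α, coord N A = 0 ∨ coord N A = 1 ∨ coord N A = -1

/-- `M` is a unimodular (regular) oriented matroid. -/
def IsUnimodular (M : OrientedMatroid α) : Prop :=
  ∃ N : Ext ℚ α, IsUnimodularPresentation N M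

open Classical in
/-- `M_E(𝒩)` for a unimodular oriented matroid `𝒩 = 𝒩(P, E)`: the value of `M_E` at a
unimodular presentation of `𝒩` (and `0` if `𝒩` is not unimodular). -/
def matME {K : Type*} [Field K] [CharZero K] (ε : GroundSetOrientation α) (g r : α → K)
    (P E : List α) (M : OrientedMatroid α) : Ext K (PortedElt α) :=
  if h : IsUnimodular M then extME ε g r P E h.choose else 0

/-- `M` is a ported oriented matroid `M(P, E)`: the sequences `P` (ports) and `E` (non-ports)
list the elements of its ground set, each exactly once. -/
def IsPorted (M : OrientedMatroid α) (P E : List α) : Prop :=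
  (P ++ E).Nodup ∧ M.ground = (P ++ E).toFinset

/-- The ground set `P_ι ⊔ P_υ`. -/
def portCopies (P : List α) : Finset (PortedElt α) :=
  (P.map PortedElt.iota ++ P.map PortedElt.upsilon).toFinset

end Unimodular

end PortedTutte

end

/-! Everything rests on one expansion of `extME`, proved in `extME_eq_sum`. Writing N and its dual
in monomials, the product ι_g(N) υ_r(N^⊥) is a double sum over the sets D and D' of non-ports taken
from N and omitted by the dual term. A non-port in D but not in D' occurs twice and kills the
product. One in D' but not in D never occurs, so contraction by E gives zero. Only D = D' survives,
and M_E(N) becomes the sum over D ⊆ E of g_D r_{E∖D} times a form `portSum` in the ports alone, with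
summands N[XD] N[QD] ε(Q(P∖Q)E) X_ι (P∖Q)_υ for X, Q ⊆ P.

This form is quadratic in N, so ±N give the same value, and the equations are read off from it.
Splitting by e ∈ D or e ∉ D gives the additive one, since N/e has the coordinates N[Ae] and the
restriction of N to the complement of e has the coordinates of N that avoid e (`extME_add`). For a
product of extensors the coordinates factor up to sign. All these signs cancel in pairs, because the
nonzero coordinates of an extensor are at sequences of one length (`portSummand_mul`). Without ports
the form is ε(E) N[D]², and for a unimodular N the number N[D]² is 1 or 0 according as D is a base
or not.

Signs are controlled by one principle, `IsAlt.perm_smul`: a product of two alternating functions of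
the same sequence does not depend on its order.

Uniqueness of the presentation up to sign (`IsUnimodularPresentation.eq_or_eq_neg`): the bases,
hence the nonzero coordinates, depend only on the oriented matroid. Normalise the factors to the
identity at a base B. Their entries are then quotients of Plücker coordinates, so 0 or ±1, and are
determined by their signs. These are signs of fundamental covectors, hence are the same for both
presentations. Contraction, restriction and product of extensors present contraction, deletion and
direct sum. Loops and coloops are exceptional, but there the two minors coincide.

Values are extensors because the dual of an extensor is one (`IsExtensor.dual`): multiplying N by a
vector on the right contracts the dual by the corresponding functional, and contraction preserves
decomposability. -/

noncomputable section

namespace PortedTutte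

/-! ### Alternating functions on sequences -/

section Alternating

variable {β γ M M' R : Type*} [AddCommGroup M] [AddCommGroup M'] [CommRing R] [Module R M]

/-- A function on sequences is alternating if exchanging adjacent entries changes the sign,
and it vanishes if two adjacent entries are equal. -/
structure IsAlt (f : List β → M) : Prop where
  swap : ∀ A x y B, f (A ++ x :: y :: B) = -f (A ++ y :: x :: B)
  dup : ∀ A x B, f (A ++ x :: x :: B) = 0

namespace IsAlt

theorem append_left {f : List β → M} (hf : IsAlt f) (C : List β) :
    IsAlt fun L => f (C ++ L) where
  swap A x y B := by simpa using hf.swap (C ++ A) x y B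
  dup A x B := by simpa using hf.dup (C ++ A) x B

theorem append_right {f : List β → M} (hf : IsAlt f) (C : List β) :
    IsAlt fun L => f (L ++ C) where
  swap A x y B := by simpa using hf.swap A x y (B ++ C)
  dup A x B := by simpa using hf.dup A x (B ++ C)

theorem map {f : List β → M} (hf : IsAlt f) (h : γ → β) : IsAlt fun L => f (L.map h) where
  swap A x y B := by simpa using hf.swap (A.map h) (h x) (h y) (B.map h)
  dup A x B := by simpa using hf.dup (A.map h) (h x) (B.map h)

theorem comp_hom {f : List β → M} (hf : IsAlt f) (φ : M →+ M') : IsAlt fun L => φ (f L) where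
  swap A x y B := by rw [hf.swap A x y B, map_neg]
  dup A x B := by rw [hf.dup A x B, map_zero]

/-- The induction runs over all alternating functions at once, because fixing the first entry leaves
an alternating function of the rest. -/
theorem perm {f : List β → M} (hf : IsAlt f) {L L' : List β} (h : L.Perm L') :
    f L = f L' ∨ f L = -f L' := by
  induction h generalizing f with
  | nil => exact .inl rfl
  | cons x _ ih => exact ih (hf.append_left [x])
  | swap x y l => exact .inr (hf.swap [] y x l)
  | trans _ _ ih₁ ih₂ =>
    rcases ih₁ hf with h₁ | h₁ <;> rcases ih₂ hf with h₂ | h₂ <;> simp [h₁, h₂]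

theorem perm_eq_zero {f : List β → M} (hf : IsAlt f) {L L' : List β} (h : L.Perm L') :
    f L = 0 ↔ f L' = 0 := by
  rcases hf.perm h with h | h <;> simp [h]

/-- A repeated entry can be permuted so that its two occurrences come first and adjacent; a
permutation only changes the sign. -/
theorem eq_zero {f : List β → M} (hf : IsAlt f) {L : List β} (h : ¬ L.Nodup) : f L = 0 := by
  obtain ⟨x, hx⟩ : ∃ x, [x, x].Sublist L := by
    by_contra hc
    exact h (List.nodup_iff_sublist.2 fun x hx => hc ⟨x, hx⟩)
  obtain ⟨l, hl⟩ := hx.exists_perm_append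
  exact (hf.perm_eq_zero hl).2 (hf.dup [] x l)

/-- The product of two alternating functions is invariant under permutations. -/
theorem perm_smul {f : List β → R} {g : List β → M} (hf : IsAlt f) (hg : IsAlt g)
    {L L' : List β} (h : L.Perm L') : f L • g L = f L' • g L' := by
  induction h generalizing f g with
  | nil => rfl
  | cons x _ ih => exact ih (hf.append_left [x]) (hg.append_left [x])
  | swap x y l =>
    have h₁ := hf.swap [] y x l
    have h₂ := hg.swap [] y x l
    simp only [List.nil_append] at h₁ h₂
    rw [h₁, h₂, neg_smul_neg]
  | trans _ _ ih₁ ih₂ => exact (ih₁ hf hg).trans (ih₂ hf hg)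

theorem perm_mul {f g : List β → R} (hf : IsAlt f) (hg : IsAlt g)
    {L L' : List β} (h : L.Perm L') : f L * g L = f L' * g L' :=
  hf.perm_smul hg h

theorem move_cons {f : List β → M} (hf : IsAlt f) (x : β) (B C : List β) :
    f (x :: (B ++ C)) = (-1 : ℤ) ^ B.length • f (B ++ x :: C) := by
  induction B generalizing f with
  | nil => simp
  | cons y B ih =>
    have h := hf.swap [] x y (B ++ C)
    simp only [List.nil_append] at h
    have h' := ih (hf.append_left [y])
    simp only [List.singleton_append] at h'
    rw [List.cons_append, h, h']
    simp [pow_succ]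

/-- Exchanging two adjacent blocks. -/
theorem swap_blocks {f : List β → M} (hf : IsAlt f) (A B C D : List β) :
    f (A ++ (B ++ (C ++ D))) = (-1 : ℤ) ^ (B.length * C.length) • f (A ++ (C ++ (B ++ D))) := by
  induction B generalizing f A with
  | nil => simp
  | cons x B ih =>
    have h := ih hf (A ++ [x])
    simp only [List.append_assoc, List.singleton_append] at h
    rw [List.cons_append, h, (hf.append_left A).move_cons x C (B ++ D), smul_smul, ← pow_add,
      List.length_cons, Nat.succ_mul, List.cons_append]

end IsAlt

end Alternating

/-- A function on sequences, alternating in the sense of permutations of the positions. -/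
theorem isAlt_of_ofFn {β : Type*} {f : List β → ℤ}
    (h : ∀ (n : ℕ) (x : Fin n → β) (σ : Equiv.Perm (Fin n)),
      f (List.ofFn (x ∘ σ)) = (Equiv.Perm.sign σ : ℤ) * f (List.ofFn x)) : IsAlt f := by
  have key : ∀ A x y B, f (A ++ x :: y :: B) = -f (A ++ y :: x :: B) := by
    intro A x y B
    set L := A ++ y :: x :: B with hL
    have hl : L.length = A.length + B.length + 2 := by simp [hL]; omega
    let i : Fin L.length := ⟨A.length, by omega⟩
    let j : Fin L.length := ⟨A.length + 1, by omega⟩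
    have hij : i ≠ j := by simp [i, j]
    have := h L.length L.get (Equiv.swap i j)
    rw [Equiv.Perm.sign_swap hij, List.ofFn_get] at this
    simp only [Units.val_neg, Units.val_one, neg_mul, one_mul] at this
    rw [← this]
    congr 1
    refine List.ext_getElem (by simp [hL]; omega) fun n h₁ h₂ => ?_
    simp only [List.getElem_ofFn, Function.comp]
    rcases eq_or_ne n A.length with rfl | hn
    · rw [show (⟨A.length, by simpa using h₂⟩ : Fin L.length) = i from rfl, Equiv.swap_apply_left]
      simp [hL, j, List.getElem_append_right]
    · rcases eq_or_ne n (A.length + 1) with rfl | hn'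
      · rw [show (⟨A.length + 1, by simpa using h₂⟩ : Fin L.length) = j from rfl,
          Equiv.swap_apply_right]
        simp [hL, i, List.getElem_append_right]
      · rw [Equiv.swap_apply_of_ne_of_ne (by simpa [i, Fin.ext_iff] using hn)
          (by simpa [j, Fin.ext_iff] using hn')]
        rcases lt_or_gt_of_ne hn with hlt | hgt
        · simp [hL, List.getElem_append_left, hlt]
        · obtain ⟨k, rfl⟩ : ∃ k, n = A.length + (k + 2) := ⟨n - A.length - 2, by omega⟩
          simp [hL, List.getElem_append_right]
  -- With x = y the exchange rule says that an integer equals its own negative.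
  refine ⟨key, fun A x B => ?_⟩
  have := key A x x B
  omega

namespace GroundSetOrientation

variable {α : Type*} (ε : GroundSetOrientation α)

theorem isAlt : IsAlt ε.sgn := isAlt_of_ofFn ε.alternating

theorem isAlt_cast (R : Type*) [CommRing R] : IsAlt fun A => (ε.sgn A : R) :=
  ε.isAlt.comp_hom (Int.castRingHom R).toAddMonoidHom

theorem mul_self {A : List α} (h : A.Nodup) : ε.sgn A * ε.sgn A = 1 := by
  rcases ε.values A with h' | h' | h'
  · exact absurd h' (ε.ne_zero A h)
  · simp [h']
  · simp [h']

end GroundSetOrientation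

/-! ### Monomials, contractions and coordinates -/

section Exterior

variable {F α : Type*} [Field F]

theorem mono_append (A B : List α) : mono F (A ++ B) = mono F A * mono F B := by
  simp [mono]

theorem mono_cons (a : α) (B : List α) : mono F (a :: B) = vec F a * mono F B := by
  simp [mono]

theorem mono_nil : mono F ([] : List α) = 1 := rfl

theorem vec_mul_self (a : α) : vec F a * vec F a = 0 := ExteriorAlgebra.ι_sq_zero _

theorem vec_mul_swap (a b : α) : vec F a * vec F b = -(vec F b * vec F a) :=
  eq_neg_of_add_eq_zero_left (ExteriorAlgebra.ι_add_mul_swap _ _)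

theorem isAlt_mono : IsAlt (mono F : List α → Ext F α) where
  swap A x y B := by
    simp only [mono_append, mono_cons]
    rw [← mul_assoc (vec F x), vec_mul_swap]
    simp [mul_assoc]
  dup A x B := by
    simp only [mono_append, mono_cons]
    rw [← mul_assoc (vec F x), vec_mul_self]
    simp

/-- Contraction by an element, as a linear map. -/
def contractLin (F : Type*) {α : Type*} [Field F] (e : α) : Ext F α →ₗ[F] Ext F α :=
  (CliffordAlgebra.contractRight (Q := (0 : QuadraticForm F (α →₀ F)))).flip (Finsupp.lapply e)

theorem contractLin_apply (e : α) (N : Ext F α) : contractLin F e N = contract N e := rfl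

theorem contract_swap (N : Ext F α) (a b : α) :
    contract (contract N a) b = -contract (contract N b) a :=
  CliffordAlgebra.contractRight_comm _ _ _

theorem contract_self (N : Ext F α) (a : α) : contract (contract N a) a = 0 :=
  CliffordAlgebra.contractRight_contractRight _ _

/-- Contraction by a sequence, as a linear map. -/
def contractListLin (F : Type*) {α : Type*} [Field F] (A : List α) : Ext F α →ₗ[F] Ext F α :=
  A.foldr (fun a f => contractLin F a ∘ₗ f) LinearMap.id

theorem contractListLin_apply (A : List α) (N : Ext F α) :
    contractListLin F A N = contractList N A := by
  induction A with
  | nil => rfl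
  | cons a A ih =>
    change contract (contractListLin F A N) a = contract (contractList N A) a
    rw [ih]

theorem contractList_cons (N : Ext F α) (a : α) (A : List α) :
    contractList N (a :: A) = contract (contractList N A) a := rfl

theorem contractList_append (N : Ext F α) (A B : List α) :
    contractList N (A ++ B) = contractList (contractList N B) A := by
  simp [contractList]

theorem contractList_zero (A : List α) : contractList (0 : Ext F α) A = 0 := by
  rw [← contractListLin_apply, map_zero]

theorem isAlt_contractList (N : Ext F α) : IsAlt (contractList N) where
  swap A x y B := by
    simp only [contractList_append, contractList_cons]
    rw [contract_swap, ← contractListLin_apply A, ← contractListLin_apply A, map_neg]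
  dup A x B := by
    simp only [contractList_append, contractList_cons]
    rw [contract_self, contractList_zero]

/-- A coordinate, as a linear functional. -/
def coordLin (F : Type*) {α : Type*} [Field F] (A : List α) : Ext F α →ₗ[F] F :=
  ExteriorAlgebra.liftAlternating (Function.update (fun _ => 0) A.length (minorForm F A))

theorem coordLin_apply (A : List α) (N : Ext F α) : coordLin F A N = coord N A := rfl

theorem coord_contractList (N : Ext F α) (A B : List α) :
    coord (contractList N A) B = coord N (B ++ A) := by
  induction A generalizing B with
  | nil => simp [contractList]
  | cons a A ih => rw [contractList_cons, coord_contract, ih]; simp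

/-- N[L] is the coordinate of N / L at the empty sequence, so the rule is inherited from the
anticommuting contractions. -/
theorem isAlt_coord (N : Ext F α) : IsAlt (coord N) := by
  have h := (isAlt_contractList N).comp_hom (coordLin F []).toAddMonoidHom
  have : (fun L => (coordLin F []).toAddMonoidHom (contractList N L)) = coord N := by
    funext L
    exact coord_contractList N L []
  rwa [this] at h

theorem contract_mul_ι (x : Ext F α) (v : α →₀ F) (e : α) :
    contract (x * ExteriorAlgebra.ι F v) e = v e • x - contract x e * ExteriorAlgebra.ι F v :=
  CliffordAlgebra.contractRight_mul_ι (Q := (0 : QuadraticForm F (α →₀ F))) (Finsupp.lapply e) v x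

theorem contract_mono_of_notMem {A : List α} {e : α} (h : e ∉ A) : contract (mono F A) e = 0 := by
  induction A using List.reverseRecOn with
  | nil => exact CliffordAlgebra.contractRight_one (Q := (0 : QuadraticForm F (α →₀ F))) _
  | append_singleton A a ih =>
    simp only [List.mem_append, List.mem_singleton, not_or] at h
    rw [mono_append, show mono F [a] = ExteriorAlgebra.ι F (Finsupp.single a 1) by simp [mono, vec],
      contract_mul_ι, ih h.1]
    simp [Ne.symm h.2]

theorem contract_mono_append_singleton {A : List α} {e : α} (h : e ∉ A) :
    contract (mono F (A ++ [e])) e = mono F A := by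
  rw [mono_append, show mono F [e] = ExteriorAlgebra.ι F (Finsupp.single e 1) by simp [mono, vec],
    contract_mul_ι, contract_mono_of_notMem h]
  simp

/-- Contracting a monomial by elements at its end. -/
theorem contractList_mono_append {A E : List α} (h : (A ++ E).Nodup) :
    contractList (mono F (A ++ E)) E = mono F A := by
  induction E generalizing A with
  | nil => simp [contractList]
  | cons e E ih =>
    have h' : (A ++ [e] ++ E).Nodup := by simpa using h
    have := ih h'
    rw [List.append_assoc, List.singleton_append] at this
    rw [contractList_cons, this, contract_mono_append_singleton]
    grind [List.nodup_append]

theorem contractList_mono_of_notMem {A E : List α} {e : α} (he : e ∈ E) (h : e ∉ A) :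
    contractList (mono F A) E = 0 := by
  classical
  -- The last entry of a sequence is contracted first, so e is moved to the end.
  have hp : (E.erase e ++ [e]).Perm E :=
    (List.perm_append_singleton e _).trans (List.perm_cons_erase he).symm
  rw [(isAlt_contractList (mono F A)).perm_eq_zero hp.symm, contractList_append]
  change contractList (contract (mono F A) e) _ = 0
  rw [contract_mono_of_notMem h, contractList_zero]

theorem coord_one_nil : coord (1 : Ext F α) [] = 1 := by
  simpa using coord_prod (F := F) (n := 0) (fun _ => (0 : α →₀ F)) [] rfl

theorem coord_mono_self {A : List α} (h : A.Nodup) : coord (mono F A) A = 1 := by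
  have := coord_contractList (mono F A) A []
  rw [List.nil_append] at this
  rw [← this]
  have h2 := contractList_mono_append (F := F) (A := []) (E := A) (by simpa using h)
  rw [List.nil_append] at h2
  rw [h2, mono_nil, coord_one_nil]

theorem coord_mono_of_notMem {A B : List α} {e : α} (he : e ∈ B) (h : e ∉ A) :
    coord (mono F A) B = 0 := by
  have := coord_contractList (mono F A) B []
  rw [List.nil_append] at this
  rw [← this, contractList_mono_of_notMem he h]
  exact map_zero (coordLin F [])

theorem coord_prod_list_ne (vs : List (α →₀ F)) {A : List α} (h : A.length ≠ vs.length) :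
    coord (vs.map (ExteriorAlgebra.ι F)).prod A = 0 := by
  have := coord_prod_ne (F := F) (fun i => vs.get i) A (Ne.symm h)
  rwa [ExteriorAlgebra.ιMulti_apply, show (List.ofFn fun i => ExteriorAlgebra.ι F (vs.get i)) =
    vs.map (ExteriorAlgebra.ι F) from by
      rw [← Function.comp_def, ← List.map_ofFn, List.ofFn_get]] at this

theorem coord_mono_of_length_ne {A B : List α} (h : B.length ≠ A.length) :
    coord (mono F A) B = 0 := by
  have := coord_prod_list_ne (F := F) (A.map fun a => Finsupp.single a 1) (A := B)
    (by simpa using h)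
  rwa [List.map_map] at this

theorem coord_mono_of_not_perm {A B : List α} (h : ¬ B.Perm A) : coord (mono F A) B = 0 := by
  by_cases hB : B.Nodup
  · by_cases hl : B.length = A.length
    · by_cases hs : B ⊆ A
      · exact absurd ((List.subperm_of_subset hB hs).perm_of_length_le hl.ge) h
      · obtain ⟨e, he, he'⟩ : ∃ e ∈ B, e ∉ A := by simpa [List.subset_def] using hs
        exact coord_mono_of_notMem he he'
    · exact coord_mono_of_length_ne hl
  · exact (isAlt_coord _).eq_zero hB

/-- The coefficient of a monomial, multiplied with an alternating function. -/
theorem coord_mono_smul {M : Type*} [AddCommGroup M] [Module F M] {f : List α → M} (hf : IsAlt f)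
    {A B : List α} (h : B.Perm A) : coord (mono F A) B • f B = f A := by
  by_cases hA : A.Nodup
  · rw [(isAlt_coord (mono F A)).perm_smul hf h, coord_mono_self hA, one_smul]
  · rw [hf.eq_zero hA, hf.eq_zero (fun hB => hA (h.nodup_iff.1 hB)), smul_zero]

end Exterior

/-! ### The exterior algebra of a finite ground set -/

section Ground

variable {F α : Type*} [Field F]

/-- The span of the monomials of the sequences of elements of `S`. -/
def groundSubmodule (F : Type*) {α : Type*} [Field F] (S : Finset α) : Submodule F (Ext F α) :=
  Submodule.span F {x | ∃ A : List α, (∀ a ∈ A, a ∈ S) ∧ mono F A = x}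

theorem mono_mem_groundSubmodule {S : Finset α} {A : List α} (h : ∀ a ∈ A, a ∈ S) :
    mono F A ∈ groundSubmodule F S :=
  Submodule.subset_span ⟨A, h, rfl⟩

theorem ι_eq_sum {S : Finset α} {v : α →₀ F} (h : ∀ a ∉ S, v a = 0) :
    ExteriorAlgebra.ι F v = ∑ a ∈ S, v a • vec F a := by
  have : v = ∑ a ∈ S, v a • Finsupp.single a (1 : F) := by
    have hs : v.support ⊆ S := fun a ha => by
      by_contra hc
      exact Finsupp.mem_support_iff.1 ha (h a hc)
    conv_lhs => rw [← v.sum_single, Finsupp.sum_of_support_subset v hs _ (by simp)]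
    simp
  conv_lhs => rw [this, map_sum]
  simp only [map_smul, vec]

theorem mono_mul_mem_groundSubmodule {S : Finset α} {A : List α} {x : Ext F α}
    (h : ∀ a ∈ A, a ∈ S) (hx : x ∈ groundSubmodule F S) : mono F A * x ∈ groundSubmodule F S := by
  induction hx using Submodule.span_induction with
  | mem x hx =>
    obtain ⟨B, hB, rfl⟩ := hx
    rw [← mono_append]
    exact mono_mem_groundSubmodule (by simpa [or_imp, forall_and] using ⟨h, hB⟩)
  | zero => simp
  | add x y _ _ hx hy => rw [mul_add]; exact add_mem hx hy
  | smul c x _ hx => rw [mul_smul_comm]; exact Submodule.smul_mem _ _ hx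

theorem prod_ι_mem_groundSubmodule {S : Finset α} {vs : List (α →₀ F)}
    (h : ∀ v ∈ vs, ∀ a ∉ S, v a = 0) :
    (vs.map (ExteriorAlgebra.ι F)).prod ∈ groundSubmodule F S := by
  induction vs with
  | nil => exact mono_mem_groundSubmodule (A := []) (by simp)
  | cons v vs ih =>
    simp only [List.mem_cons, forall_eq_or_imp] at h
    rw [List.map_cons, List.prod_cons, ι_eq_sum h.1, Finset.sum_mul]
    refine sum_mem fun a ha => ?_
    rw [smul_mul_assoc, show vec F a = mono F [a] by simp [mono]]
    exact Submodule.smul_mem _ _ (mono_mul_mem_groundSubmodule (by simpa using ha) (ih h.2))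

theorem IsFactorization.mem_groundSubmodule {S : Finset α} {N : Ext F α} {c : F}
    {vs : List (α →₀ F)} (h : IsFactorization S N c vs) : N ∈ groundSubmodule F S := by
  rw [h.2]
  exact Submodule.smul_mem _ _ (prod_ι_mem_groundSubmodule h.1)

/-- The expansion in monomials. -/
theorem eq_sum_coord {S : Finset α} {N : Ext F α} (h : N ∈ groundSubmodule F S) :
    N = ∑ A ∈ S.powerset, coord N A.toList • mono F A.toList := by
  classical
  induction h using Submodule.span_induction with
  | mem x hx =>
    obtain ⟨L, hL, rfl⟩ := hx
    by_cases hn : L.Nodup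
    · rw [Finset.sum_eq_single L.toFinset]
      · rw [coord_mono_smul isAlt_mono]
        exact List.toFinset_toList hn
      · intro A _ hA
        rw [coord_mono_of_not_perm, zero_smul]
        intro hp
        apply hA
        rw [← List.toFinset_eq_of_perm _ _ hp, Finset.toList_toFinset]
      · intro hc
        exact absurd (Finset.mem_powerset.2 fun a ha => hL a (List.mem_toFinset.1 ha)) hc
    · rw [isAlt_mono.eq_zero hn]
      simp [← coordLin_apply]
  | zero => simp [← coordLin_apply]
  | add x y _ _ hx hy =>
    conv_lhs => rw [hx, hy]
    simp [← coordLin_apply, add_smul, Finset.sum_add_distrib]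
  | smul c x _ hx =>
    conv_lhs => rw [hx]
    simp [← coordLin_apply, mul_smul, Finset.smul_sum]

/-- Plücker coordinates separate elements with a finite ground set; this turns identities between
extensors into identities between minors. -/
theorem ext_coord {S : Finset α} {N N' : Ext F α} (h : N ∈ groundSubmodule F S)
    (h' : N' ∈ groundSubmodule F S) (hc : ∀ A : List α, coord N A = coord N' A) : N = N' := by
  rw [eq_sum_coord h, eq_sum_coord h']
  simp [hc]

theorem coord_eq_zero_of_notMem {S : Finset α} {N : Ext F α} (h : N ∈ groundSubmodule F S)
    {A : List α} {a : α} (ha : a ∈ A) (haS : a ∉ S) : coord N A = 0 := by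
  induction h using Submodule.span_induction with
  | mem x hx =>
    obtain ⟨L, hL, rfl⟩ := hx
    exact coord_mono_of_notMem ha fun h => haS (hL a h)
  | zero => simp [← coordLin_apply]
  | add x y _ _ hx hy => simp [← coordLin_apply] at *; simp [hx, hy]
  | smul c x _ hx => simp [← coordLin_apply] at *; simp [hx]

theorem exists_coord_ne_zero {S : Finset α} {N : Ext F α} (h : N ∈ groundSubmodule F S)
    (h0 : N ≠ 0) : ∃ A : List α, coord N A ≠ 0 ∧ A.Nodup ∧ ∀ a ∈ A, a ∈ S := by
  obtain ⟨A, hA⟩ : ∃ A : List α, coord N A ≠ 0 := by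
    by_contra! hc
    exact h0 (ext_coord h (zero_mem _) fun A => by rw [hc A]; simp [← coordLin_apply])
  refine ⟨A, hA, ?_, fun a ha => ?_⟩
  · by_contra hn
    exact hA ((isAlt_coord N).eq_zero hn)
  · by_contra hn
    exact hA (coord_eq_zero_of_notMem h ha hn)

end Ground

/-! ### Sums over subsets -/

section Powerset

variable {α M : Type*} [DecidableEq α] [AddCommMonoid M]

theorem sum_powerset_union {U V : Finset α} (h : Disjoint U V) (f : Finset α → M) :
    ∑ X ∈ (U ∪ V).powerset, f X = ∑ A ∈ U.powerset, ∑ B ∈ V.powerset, f (A ∪ B) := by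
  rw [← Finset.sum_product']
  refine (Finset.sum_nbij' (fun q => q.1 ∪ q.2) (fun X => (X ∩ U, X ∩ V)) ?_ ?_ ?_ ?_ ?_).symm
  · rintro ⟨A, B⟩ hq
    simp only [Finset.mem_product, Finset.mem_powerset] at hq ⊢
    exact Finset.union_subset_union hq.1 hq.2
  · intro X _
    simp
  · rintro ⟨A, B⟩ hq
    simp only [Finset.mem_product, Finset.mem_powerset] at hq
    have h1 := Finset.disjoint_left.1 h
    ext a <;> simp only [Finset.mem_inter, Finset.mem_union]
    · exact ⟨fun ⟨h2, h3⟩ => h2.resolve_right fun h4 => h1 h3 (hq.2 h4),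
        fun h2 => ⟨.inl h2, hq.1 h2⟩⟩
    · exact ⟨fun ⟨h2, h3⟩ => h2.resolve_left fun h4 => h1 (hq.1 h4) h3,
        fun h2 => ⟨.inr h2, hq.2 h2⟩⟩
  · intro X hX
    simp only [Finset.mem_powerset] at hX
    rw [← Finset.inter_union_distrib_left]
    exact Finset.inter_eq_left.2 hX
  · intros; rfl

theorem sum_powerset_sdiff (S : Finset α) (f : Finset α → M) :
    ∑ X ∈ S.powerset, f X = ∑ X ∈ S.powerset, f (S \ X) :=
  Finset.sum_nbij' (fun X => S \ X) (fun X => S \ X) (by simp) (by simp)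
    (fun X hX => by simpa using Finset.mem_powerset.1 hX)
    (fun X hX => by simpa using Finset.mem_powerset.1 hX)
    (fun X hX => by rw [Finset.sdiff_sdiff_eq_self (Finset.mem_powerset.1 hX)])

theorem toList_union_perm {A B : Finset α} (h : Disjoint A B) :
    (A ∪ B).toList.Perm (A.toList ++ B.toList) := by
  refine (List.perm_ext_iff_of_nodup (Finset.nodup_toList _) ?_).2 (by simp)
  rw [List.nodup_append]
  refine ⟨Finset.nodup_toList _, Finset.nodup_toList _, fun a ha b hb => ?_⟩
  rintro rfl
  exact Finset.disjoint_left.1 h (Finset.mem_toList.1 ha) (Finset.mem_toList.1 hb)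

theorem toList_sdiff_perm {A B : Finset α} (h : A ⊆ B) :
    (A.toList ++ (B \ A).toList).Perm B.toList := by
  refine (toList_union_perm Finset.disjoint_sdiff).symm.trans ?_
  rw [Finset.union_sdiff_of_subset h]

theorem toList_toFinset_perm {A : List α} (h : A.Nodup) : A.toFinset.toList.Perm A :=
  List.toFinset_toList h

end Powerset

/-! ### The expansion of `M_E(N)` -/

section Copies

variable {α : Type*}

/-- The element of which an element of the ported ground set is a copy. -/
def PortedElt.base : PortedElt α → α
  | elem e => e
  | iota p => p
  | upsilon p => p

theorem PortedElt.elem_injective : Function.Injective (elem : α → PortedElt α) :=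
  fun _ _ h => by injection h

theorem PortedElt.iota_injective : Function.Injective (iota : α → PortedElt α) :=
  fun _ _ h => by injection h

theorem PortedElt.upsilon_injective : Function.Injective (upsilon : α → PortedElt α) :=
  fun _ _ h => by injection h

/-- The contraction of a product of monomials in which each non-port occurs once. -/
theorem contractList_port_mono {K : Type*} [Field K] (ε : GroundSetOrientation α)
    {X Y Q D R E : List α}
    (hX : X.Nodup) (hY : Y.Nodup) (hE : E.Nodup) (h : (D ++ R).Perm E) :
    (ε.sgn ((Q ++ D) ++ (R ++ Y)) : K) • contractList
        (mono K (X.map .iota ++ D.map .elem) * mono K (R.map .elem ++ Y.map .upsilon))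
        (E.map .elem) =
      (ε.sgn (Q ++ Y ++ E) : K) • mono K (X.map PortedElt.iota ++ Y.map .upsilon) := by
  have hp : (D.map .elem ++ R.map .elem ++ Y.map .upsilon : List (PortedElt α)).Perm
      (Y.map .upsilon ++ E.map .elem) := by
    rw [← List.map_append]
    exact (List.perm_append_comm).trans ((h.map _).append_left _)
  -- Forgetting the copies with `PortedElt.base` makes ε and the monomial alternating functions of
  -- one and the same sequence, so that both absorb the reordering `hp` simultaneously and no
  -- explicit sign appears.
  have hf : IsAlt fun L : List (PortedElt α) => (ε.sgn (Q ++ L.map PortedElt.base) : K) :=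
    ((ε.isAlt_cast K).append_left Q).map _
  have key := hf.perm_smul ((isAlt_mono (F := K)).append_left (X.map .iota)) hp
  have hb : ∀ L : List α, (L.map PortedElt.elem).map PortedElt.base = L ∧
      (L.map PortedElt.upsilon).map PortedElt.base = L := by
    intro L; constructor <;> · rw [List.map_map]; exact List.map_id _
  simp only [List.map_append, (hb _).1, (hb _).2] at key
  rw [← mono_append, ← contractListLin_apply, ← map_smul]
  have e1 : Q ++ D ++ (R ++ Y) = Q ++ (D ++ R ++ Y) := by simp
  have e2 : X.map PortedElt.iota ++ D.map .elem ++ (R.map .elem ++ Y.map .upsilon) =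
    X.map .iota ++ (D.map .elem ++ R.map .elem ++ Y.map .upsilon) := by simp
  rw [e1, e2, key, map_smul, contractListLin_apply,
    ← List.append_assoc (X.map PortedElt.iota), contractList_mono_append, ← List.append_assoc]
  rw [List.nodup_append, List.nodup_append]
  refine ⟨⟨hX.map PortedElt.iota_injective, hY.map PortedElt.upsilon_injective, ?_⟩,
    hE.map PortedElt.elem_injective, ?_⟩
  · simp
  · rintro a ha b hb rfl
    obtain ⟨e, -, rfl⟩ := List.mem_map.1 hb
    simp at ha

end Copies

section Expansion

variable {F K α : Type*} [Field F] [Field K] [Algebra F K] [DecidableEq α]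

theorem eq_sum_coord_union {S T : Finset α} (hd : Disjoint S T) {N : Ext F α}
    (h : N ∈ groundSubmodule F (S ∪ T)) :
    N = ∑ X ∈ S.powerset, ∑ D ∈ T.powerset,
      coord N (X.toList ++ D.toList) • mono F (X.toList ++ D.toList) := by
  conv_lhs => rw [eq_sum_coord h, sum_powerset_union hd]
  refine Finset.sum_congr rfl fun X hX => Finset.sum_congr rfl fun D hD => ?_
  exact (isAlt_coord N).perm_smul isAlt_mono (toList_union_perm
    (hd.mono (Finset.mem_powerset.1 hX) (Finset.mem_powerset.1 hD)))

/-- The sum is indexed by the complement Q ∪ D of the monomial's support, so that D means the same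
as in the expansion of N. The non-ports of the dual are listed first, next to those of N in the
product. -/
theorem dual_eq_sum_union (ε : GroundSetOrientation α) {S T : Finset α} (hd : Disjoint S T)
    (N : Ext F α) :
    dual ε (S ∪ T) N = ∑ Q ∈ S.powerset, ∑ D ∈ T.powerset,
      (coord N (Q.toList ++ D.toList) *
        (ε.sgn ((Q.toList ++ D.toList) ++ ((T \ D).toList ++ (S \ Q).toList)) : F)) •
          mono F ((T \ D).toList ++ (S \ Q).toList) := by
  rw [dual, sum_powerset_sdiff, sum_powerset_union hd]
  refine Finset.sum_congr rfl fun Q hQ => Finset.sum_congr rfl fun D hD => ?_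
  have hQ' := Finset.mem_powerset.1 hQ
  have hD' := Finset.mem_powerset.1 hD
  have e1 : (S ∪ T) \ ((S ∪ T) \ (Q ∪ D)) = Q ∪ D :=
    Finset.sdiff_sdiff_eq_self (Finset.union_subset_union hQ' hD')
  have e2 : (S ∪ T) \ (Q ∪ D) = (T \ D) ∪ (S \ Q) := by
    have := Finset.disjoint_left.1 hd
    ext a
    simp only [Finset.mem_sdiff, Finset.mem_union]
    grind
  rw [e1, e2]
  have p1 := toList_union_perm (hd.mono hQ' hD')
  have p2 := toList_union_perm (A := T \ D) (B := S \ Q)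
    (hd.symm.mono Finset.sdiff_subset Finset.sdiff_subset)
  have q1 := (isAlt_coord N).perm_mul
    ((ε.isAlt_cast F).append_right ((T \ D) ∪ (S \ Q)).toList) p1
  have q2 := ((ε.isAlt_cast F).append_left (Q.toList ++ D.toList)).perm_smul
    (isAlt_mono (F := F)) p2
  rw [q1, mul_smul, mul_smul, q2]

theorem substHom_vec (copy : α → PortedElt α) (w : α → K) (P : List α) (a : α) :
    substHom F copy w P (vec F a) =
      (if a ∈ P then 1 else w a) • vec K (if a ∈ P then copy a else .elem a) := by
  refine (ExteriorAlgebra.lift_ι_apply F _ _ _).trans ?_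
  simp only [LinearMap.comp_apply, Finsupp.linearCombination_single, one_smul, vec,
    LinearMap.restrictScalars_apply]
  split_ifs
  · simp
  · rw [← map_smul, Finsupp.smul_single, smul_eq_mul, mul_one]

theorem substHom_mono (copy : α → PortedElt α) (w : α → K) (P A : List α) :
    substHom F copy w P (mono F A) =
      (A.map fun a => if a ∈ P then 1 else w a).prod •
        mono K (A.map fun a => if a ∈ P then copy a else .elem a) := by
  induction A with
  | nil => simp [mono]
  | cons a A ih =>
    rw [mono_cons, map_mul, ih, substHom_vec, smul_mul_smul_comm, List.map_cons, List.map_cons,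
      List.prod_cons, mono_cons]

theorem substHom_map_of_mem (copy : α → PortedElt α) (w : α → K) {P X : List α}
    (hX : ∀ a ∈ X, a ∈ P) :
    (X.map fun a => if a ∈ P then copy a else .elem a) = X.map copy ∧
    (X.map fun a => if a ∈ P then 1 else w a).prod = 1 := by
  constructor
  · exact List.map_congr_left fun a ha => by simp [hX a ha]
  · refine List.prod_eq_one fun x hx => ?_
    obtain ⟨a, ha, rfl⟩ := List.mem_map.1 hx
    simp [hX a ha]

theorem substHom_map_of_notMem (copy : α → PortedElt α) (w : α → K) {P D : List α}
    (hD : ∀ a ∈ D, a ∉ P) :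
    (D.map fun a => if a ∈ P then copy a else .elem a) = D.map .elem ∧
    (D.map fun a => if a ∈ P then 1 else w a) = D.map w :=
  ⟨List.map_congr_left fun a ha => by simp [hD a ha],
    List.map_congr_left fun a ha => by simp [hD a ha]⟩

theorem substHom_iota (w : α → K) {P X : List α} {D : Finset α} (hX : ∀ a ∈ X, a ∈ P)
    (hD : ∀ a ∈ D, a ∉ P) :
    substHom F .iota w P (mono F (X ++ D.toList)) =
      (∏ e ∈ D, w e) • mono K (X.map .iota ++ D.toList.map .elem) := by
  obtain ⟨h1, h2⟩ := substHom_map_of_mem .iota w hX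
  obtain ⟨h3, h4⟩ := substHom_map_of_notMem .iota w (D := D.toList) (by simpa using hD)
  rw [substHom_mono, List.map_append, List.map_append, List.prod_append, h1, h2, h3, h4, one_mul,
    Finset.prod_map_toList]

theorem substHom_upsilon (w : α → K) {P X : List α} {D : Finset α} (hX : ∀ a ∈ X, a ∈ P)
    (hD : ∀ a ∈ D, a ∉ P) :
    substHom F .upsilon w P (mono F (D.toList ++ X)) =
      (∏ e ∈ D, w e) • mono K (D.toList.map .elem ++ X.map .upsilon) := by
  obtain ⟨h1, h2⟩ := substHom_map_of_mem .upsilon w hX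
  obtain ⟨h3, h4⟩ := substHom_map_of_notMem .upsilon w (D := D.toList) (by simpa using hD)
  rw [substHom_mono, List.map_append, List.map_append, List.prod_append, h1, h2, h3, h4, mul_one,
    Finset.prod_map_toList]

/-- The off-diagonal terms: a non-port in D' but not in D is missing from the product, while one in
D but not in D' occurs twice. -/
theorem contractList_port_mono_eq_zero {X Y E : List α} {D D' : Finset α}
    (hD : D ⊆ E.toFinset) (hD' : D' ⊆ E.toFinset) (h : D ≠ D') :
    contractList (mono K (X.map PortedElt.iota ++ D.toList.map PortedElt.elem) *
      mono K ((E.toFinset \ D').toList.map PortedElt.elem ++ Y.map PortedElt.upsilon))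
      (E.map PortedElt.elem) = 0 := by
  rw [← mono_append]
  by_cases hs : D ⊆ D'
  · obtain ⟨e, he, he'⟩ := Finset.exists_of_ssubset (hs.ssubset_of_ne h)
    apply contractList_mono_of_notMem (e := .elem e)
    · simpa using hD' he
    · simp [he, he']
  · obtain ⟨e, he, he'⟩ := Finset.not_subset.1 hs
    rw [isAlt_mono.eq_zero, contractList_zero]
    intro hn
    rw [List.nodup_append] at hn
    exact hn.2.2 (.elem e) (by simp [he]) (.elem e) (by simpa [he'] using hD he) rfl

/-- The contribution of the sets listed by `X`, `Q` and `Y = P ∖ Q` to the part of `M_E(N)` in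
which the non-ports in `D` come from `N`. -/
def portSummand (K : Type*) [Field K] [Algebra F K] (ε : GroundSetOrientation α) (E D : List α)
    (N : Ext F α) (X Q Y : List α) : Ext K (PortedElt α) :=
  (algebraMap F K (coord N (X ++ D) * coord N (Q ++ D)) * (ε.sgn (Q ++ Y ++ E) : K)) •
    mono K (X.map PortedElt.iota ++ Y.map .upsilon)

/-- The part of `M_E(N)` in which the non-ports in `D` come from `N` and the other non-ports
from `N^⊥`. -/
def portSum (K : Type*) [Field K] [Algebra F K] (ε : GroundSetOrientation α) (P E D : List α)
    (N : Ext F α) : Ext K (PortedElt α) :=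
  ∑ Q ∈ P.toFinset.powerset, ∑ X ∈ P.toFinset.powerset,
    portSummand K ε E D N X.toList Q.toList (P.toFinset \ Q).toList

/-- D enters through two coordinates, whose sign changes cancel. -/
theorem portSum_perm (ε : GroundSetOrientation α) (P E : List α) {D D' : List α}
    (h : D.Perm D') (N : Ext F α) : portSum K ε P E D N = portSum K ε P E D' N := by
  refine Finset.sum_congr rfl fun Q _ => Finset.sum_congr rfl fun X _ => ?_
  rw [portSummand, portSummand,
    ((isAlt_coord N).append_left X.toList).perm_mul ((isAlt_coord N).append_left Q.toList) h]

/-- The central expansion. All later identities compare it term by term, with the non-port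
parameters separated from the port part. -/
theorem extME_eq_sum (ε : GroundSetOrientation α) (g r : α → K) {P E : List α}
    (hPE : (P ++ E).Nodup) {N : Ext F α} (hN : N ∈ groundSubmodule F (P ++ E).toFinset) :
    extME ε g r P E N = ∑ D ∈ E.toFinset.powerset,
      ((∏ e ∈ D, g e) * ∏ e ∈ E.toFinset \ D, r e) • portSum K ε P E D.toList N := by
  have hE : E.Nodup := (List.nodup_append.1 hPE).2.1
  have hdis : Disjoint P.toFinset E.toFinset := by
    rw [List.disjoint_toFinset_iff_disjoint]
    exact List.disjoint_of_nodup_append hPE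
  have hmem : ∀ {D : Finset α}, D ⊆ E.toFinset → ∀ a ∈ D, a ∉ P := fun hD a ha hP =>
    Finset.disjoint_left.1 hdis (List.mem_toFinset.2 hP) (hD ha)
  rw [List.toFinset_append] at hN
  have h1 : substHom F .iota g P N = ∑ X ∈ P.toFinset.powerset, ∑ D ∈ E.toFinset.powerset,
      algebraMap F K (coord N (X.toList ++ D.toList)) •
        (∏ e ∈ D, g e) • mono K (X.toList.map .iota ++ D.toList.map .elem) := by
    conv_lhs => rw [eq_sum_coord_union hdis hN]
    simp only [map_sum]
    refine Finset.sum_congr rfl fun X hX => Finset.sum_congr rfl fun D hD => ?_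
    rw [map_smul, substHom_iota, algebraMap_smul]
    · intro a ha
      simpa using Finset.mem_powerset.1 hX (Finset.mem_toList.1 ha)
    · exact hmem (Finset.mem_powerset.1 hD)
  have h2 : substHom F .upsilon r P (dual ε (P ++ E).toFinset N) =
      ∑ Q ∈ P.toFinset.powerset, ∑ D ∈ E.toFinset.powerset,
      (algebraMap F K (coord N (Q.toList ++ D.toList)) *
        (ε.sgn ((Q.toList ++ D.toList) ++
          ((E.toFinset \ D).toList ++ (P.toFinset \ Q).toList)) : K)) •
        (∏ e ∈ E.toFinset \ D, r e) • mono K ((E.toFinset \ D).toList.map .elem ++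
          (P.toFinset \ Q).toList.map .upsilon) := by
    rw [List.toFinset_append, dual_eq_sum_union ε hdis]
    simp only [map_sum]
    refine Finset.sum_congr rfl fun Q hQ => Finset.sum_congr rfl fun D hD => ?_
    rw [map_smul, substHom_upsilon, ← algebraMap_smul K, map_mul, map_intCast]
    · intro a ha
      simpa using (Finset.mem_sdiff.1 (Finset.mem_toList.1 ha)).1
    · exact hmem Finset.sdiff_subset
  rw [extME, extM, h1, h2, ← contractListLin_apply]
  simp only [Finset.sum_mul, Finset.mul_sum, map_sum, smul_mul_smul_comm, map_smul,
    contractListLin_apply, portSum, portSummand, Finset.smul_sum]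
  rw [Finset.sum_comm]
  refine Finset.sum_congr rfl fun D hD => ?_
  rw [Finset.sum_comm]
  refine Finset.sum_comm.trans (Finset.sum_congr rfl fun Q _ => Finset.sum_congr rfl fun X _ => ?_)
  have hD' := Finset.mem_powerset.1 hD
  -- Here D comes from the dual and the inner sum runs over the non-port sets of N.
  rw [Finset.sum_eq_single D]
  · have hp : (D.toList ++ (E.toFinset \ D).toList).Perm E :=
      (toList_sdiff_perm hD').trans (toList_toFinset_perm hE)
    have key := contractList_port_mono (K := K) ε (Q := Q.toList) (Finset.nodup_toList X)
      (Finset.nodup_toList (P.toFinset \ Q)) hE hp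
    rw [map_mul, smul_smul, mul_comm _ (_ * _), ← mul_smul, ← mul_assoc, ← mul_assoc, mul_smul, key,
      smul_smul]
    congr 1
    ring
  · intro D₁ hD₁ hne
    rw [contractList_port_mono_eq_zero (Finset.mem_powerset.1 hD₁) hD' hne, smul_zero, smul_zero]
  · exact fun h => absurd hD h

end Expansion

/-! ### Coordinates of products and restrictions -/

section Products

variable {F α : Type*} [Field F]

/-- Since S and T are disjoint, a permutation between the concatenations restricts to one on each
block, and its sign is the product of the two signs. -/
theorem coord_mono_append {S T : Finset α} (hd : Disjoint S T) {A A' B B' : List α}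
    (hA : ∀ a ∈ A, a ∈ S) (hA' : ∀ a ∈ A', a ∈ T) (hB : ∀ a ∈ B, a ∈ S) (hB' : ∀ a ∈ B', a ∈ T) :
    coord (mono F (A ++ A')) (B ++ B') = coord (mono F A) B * coord (mono F A') B' := by
  have hdis := Finset.disjoint_left.1 hd
  by_cases hp : (B ++ B').Perm (A ++ A')
  · classical
    have hfilter : ∀ L L' : List α, (∀ a ∈ L, a ∈ S) → (∀ a ∈ L', a ∈ T) →
        (L ++ L').filter (· ∈ S) = L ∧ (L ++ L').filter (· ∉ S) = L' := by
      intro L L' hL hL'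
      have h1 : L.filter (· ∈ S) = L := List.filter_eq_self.2 (by simpa using hL)
      have h2 : L'.filter (· ∈ S) = [] :=
        List.filter_eq_nil_iff.2 fun a ha => by simpa using fun h => hdis h (hL' a ha)
      have h3 : L.filter (· ∉ S) = [] :=
        List.filter_eq_nil_iff.2 fun a ha => by simpa using hL a ha
      have h4 : L'.filter (· ∉ S) = L' :=
        List.filter_eq_self.2 fun a ha => by simpa using fun h => hdis h (hL' a ha)
      simp only [List.filter_append, h1, h2, h3, h4, List.append_nil, List.nil_append, and_self]
    have p1 : B.Perm A := by
      have := hp.filter (· ∈ S)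
      rwa [(hfilter _ _ hB hB').1, (hfilter _ _ hA hA').1] at this
    have p2 : B'.Perm A' := by
      have := hp.filter (· ∉ S)
      rwa [(hfilter _ _ hB hB').2, (hfilter _ _ hA hA').2] at this
    by_cases hn : (A ++ A').Nodup
    · have hnA := (List.nodup_append.1 hn).1
      have hnA' := (List.nodup_append.1 hn).2.1
      have e1 := (isAlt_coord (mono F A)).perm_mul
        ((isAlt_coord (mono F (A ++ A'))).append_right B') p1
      have e2 := (isAlt_coord (mono F A')).perm_mul
        ((isAlt_coord (mono F (A ++ A'))).append_left A) p2
      simp only [coord_mono_self hnA, coord_mono_self hnA', coord_mono_self hn, one_mul] at e1 e2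
      have hsq : ∀ {L L' : List α}, L'.Nodup → L.Perm L' →
          coord (mono F L') L * coord (mono F L') L = 1 := by
        intro L L' hL' h
        have := (isAlt_coord (mono F L')).perm_mul (isAlt_coord (mono F L')) h
        simpa [coord_mono_self hL'] using this
      -- With s, t the coordinates at `B`, `B'` and x, y those of the product at `B ++ B'`, `A ++
      -- B'`: s x = y, t y = 1 and s² = t² = 1, whence x = s t.
      linear_combination -coord (mono F (A ++ A')) (B ++ B') * hsq hnA p1 +
        coord (mono F A) B * e1
          - coord (mono F A) B * coord (mono F (A ++ A')) (A ++ B') * hsq hnA' p2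
          + coord (mono F A) B * coord (mono F A') B' * e2
    · rw [isAlt_mono.eq_zero hn]
      rw [List.nodup_append] at hn
      have : ¬ A.Nodup ∨ ¬ A'.Nodup := by
        by_contra! hc
        refine hn ⟨hc.1, hc.2, fun a ha b hb hab => ?_⟩
        subst hab
        exact hdis (hA a ha) (hA' a hb)
      rcases this with h | h <;> rw [isAlt_mono.eq_zero h] <;> simp [← coordLin_apply]
  · rw [coord_mono_of_not_perm hp]
    by_cases h1 : B.Perm A
    · have h2 : ¬ B'.Perm A' := fun h2 => hp (h1.append h2)
      rw [coord_mono_of_not_perm h2, mul_zero]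
    · rw [coord_mono_of_not_perm h1, zero_mul]

/-- Plücker coordinates of the product of two elements with disjoint ground sets. -/
theorem coord_mul {S T : Finset α} (hd : Disjoint S T) {N N' : Ext F α}
    (hN : N ∈ groundSubmodule F S) (hN' : N' ∈ groundSubmodule F T) {B B' : List α}
    (hB : ∀ a ∈ B, a ∈ S) (hB' : ∀ a ∈ B', a ∈ T) :
    coord (N * N') (B ++ B') = coord N B * coord N' B' := by
  induction hN using Submodule.span_induction with
  | mem x hx =>
    obtain ⟨A, hA, rfl⟩ := hx
    induction hN' using Submodule.span_induction with
    | mem y hy =>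
      obtain ⟨A', hA', rfl⟩ := hy
      rw [← mono_append, coord_mono_append hd hA hA' hB hB']
    | zero => simp [← coordLin_apply]
    | add y z _ _ hy hz =>
      simp only [← coordLin_apply, mul_add, map_add] at *
      rw [hy, hz]
    | smul c y _ hy =>
      simp only [← coordLin_apply, mul_smul_comm, map_smul, smul_eq_mul] at *
      rw [hy]; ring
  | zero => simp [← coordLin_apply]
  | add y z _ _ hy hz =>
    simp only [← coordLin_apply, add_mul, map_add] at *
    rw [hy, hz]
  | smul c y _ hy =>
    simp only [← coordLin_apply, smul_mul_assoc, map_smul, smul_eq_mul] at *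
    rw [hy]; ring

open Classical in
/-- The projection of vectors to the coordinates in `B`. -/
def restrictLin (F : Type*) {α : Type*} [Field F] (B : Set α) : (α →₀ F) →ₗ[F] (α →₀ F) :=
  (Finsupp.supported F F B).subtype ∘ₗ Finsupp.restrictDom F F B

open Classical in
theorem restrictLin_apply (B : Set α) (v : α →₀ F) (a : α) :
    restrictLin F B v a = if a ∈ B then v a else 0 := by
  change Finsupp.filter (· ∈ B) v a = _
  rw [Finsupp.filter_apply]

/-- The restriction of an element of the exterior algebra to the coordinates in `B`. -/
def restrictExt (B : Set α) (N : Ext F α) : Ext F α :=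
  ExteriorAlgebra.map (restrictLin F B) N

theorem restrictExt_mono (B : Set α) (L : List α) (h : ∀ a ∈ L, a ∈ B) :
    restrictExt B (mono F L) = mono F L := by
  induction L with
  | nil => exact map_one _
  | cons a L ih =>
    simp only [List.mem_cons, forall_eq_or_imp] at h
    have ih := ih h.2
    rw [restrictExt] at ih ⊢
    have : restrictLin F B (Finsupp.single a 1) = Finsupp.single a 1 := by
      classical
      ext b
      rw [restrictLin_apply]
      split_ifs with hb
      · rfl
      · rw [Finsupp.single_apply, if_neg]
        rintro rfl
        exact hb h.1
    rw [mono_cons, map_mul, ih, vec, ExteriorAlgebra.map_apply_ι, this]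

theorem restrictExt_mono_of_notMem {B : Set α} {L : List α} {a : α} (ha : a ∈ L) (h : a ∉ B) :
    restrictExt B (mono F L) = 0 := by
  obtain ⟨L₁, L₂, rfl⟩ := List.append_of_mem ha
  have : restrictLin F B (Finsupp.single a 1) = 0 := by
    classical
    ext b
    rw [restrictLin_apply]
    split_ifs with hb
    · rw [Finsupp.single_apply, if_neg, Finsupp.zero_apply]
      rintro rfl
      exact h hb
    · rfl
  rw [restrictExt, mono_append, mono_cons, map_mul, map_mul, vec, ExteriorAlgebra.map_apply_ι, this]
  simp

/-- Restriction fixes the monomials with all letters in B and kills the others, which have no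
coordinate at a sequence in B anyway. -/
theorem coord_restrictExt {S : Finset α} {N : Ext F α} (hN : N ∈ groundSubmodule F S) (B : Set α)
    {A : List α} (h : ∀ a ∈ A, a ∈ B) : coord (restrictExt B N) A = coord N A := by
  induction hN using Submodule.span_induction with
  | mem x hx =>
    obtain ⟨L, hL, rfl⟩ := hx
    by_cases hLB : ∀ a ∈ L, a ∈ B
    · rw [restrictExt_mono B L hLB]
    · push Not at hLB
      obtain ⟨a, ha, haB⟩ := hLB
      rw [restrictExt_mono_of_notMem ha haB, coord_mono_of_not_perm, ← coordLin_apply, map_zero]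
      exact fun hp => haB (h a (hp.mem_iff.2 ha))
  | zero => simp [restrictExt]
  | add x y _ _ hx hy =>
    simp only [← coordLin_apply, restrictExt, map_add] at *
    rw [hx, hy]
  | smul c x _ hx =>
    simp only [← coordLin_apply, restrictExt, map_smul] at *
    rw [hx]

theorem restrictExt_smul_prod (B : Set α) (c : F) (vs : List (α →₀ F)) :
    restrictExt B (c • (vs.map (ExteriorAlgebra.ι F)).prod) =
      c • ((vs.map (restrictLin F B)).map (ExteriorAlgebra.ι F)).prod := by
  rw [restrictExt, map_smul, map_list_prod, List.map_map, List.map_map]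
  congr 3
  funext v
  exact ExteriorAlgebra.map_apply_ι _ _

end Products

/-! ### Deletion, contraction and products in `M_E(N)` -/

section Equations

variable {F K α : Type*} [Field F] [Field K] [Algebra F K]

/-- Each of X, Q and Y occurs in exactly two alternating factors: X in a coordinate and the
monomial, Q in a coordinate and ε, Y in ε and the monomial. -/
theorem portSummand_perm (ε : GroundSetOrientation α) (E D : List α) (N : Ext F α)
    {X X' Q Q' Y Y' : List α} (hX : X.Perm X') (hQ : Q.Perm Q') (hY : Y.Perm Y') :
    portSummand K ε E D N X Q Y = portSummand K ε E D N X' Q' Y' := by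
  have hc : IsAlt fun L => algebraMap F K (coord N (L ++ D)) :=
    ((isAlt_coord N).append_right D).comp_hom (algebraMap F K).toAddMonoidHom
  have hm : IsAlt (mono K : List (PortedElt α) → Ext K (PortedElt α)) := isAlt_mono
  have h1 := hc.perm_smul ((hm.append_right (Y.map .upsilon)).map .iota) hX
  have h2 := hc.perm_mul ((ε.isAlt_cast K).append_right (Y ++ E)) hQ
  have h3 := (((ε.isAlt_cast K).append_right E).append_left Q').perm_smul
    ((hm.append_left (X'.map .iota)).map .upsilon) hY
  simp only [← List.append_assoc] at h2 h3
  rw [portSummand, portSummand, map_mul, map_mul, mul_assoc, h2, mul_comm, mul_smul, h1,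
    mul_smul, smul_comm (ε.sgn _ : K), h3, smul_smul, smul_smul]
  congr 1
  ring

/-- Sorting the entries by summand costs (-1)^(|X₂||D₁|) and (-1)^(|Q₂||D₁|) in the two coordinates,
(-1)^(|Q₂||Y₁|) in ε and (-1)^(|X₂||Y₁|) in the monomial. Homogeneity of N₂ forces |X₂| = |Q₂|, so
these cancel in pairs and only the global ε factors remain. -/
theorem portSummand_mul (ε : GroundSetOrientation α) {S T : Finset α} (hd : Disjoint S T)
    {N₁ N₂ : Ext F α} (hN₁ : N₁ ∈ groundSubmodule F S) (hN₂ : N₂ ∈ groundSubmodule F T)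
    {n : ℕ} (hn : ∀ A, coord N₂ A ≠ 0 → A.length = n)
    {P₁ E₁ P₂ E₂ E D₁ D₂ X₁ X₂ Q₁ Q₂ Y₁ Y₂ : List α}
    (hS : ∀ a, a ∈ P₁ ++ E₁ → a ∈ S) (hT : ∀ a, a ∈ P₂ ++ E₂ → a ∈ T)
    (hn₁ : (P₁ ++ E₁).Nodup) (hn₂ : (P₂ ++ E₂).Nodup)
    (hD₁ : ∀ a ∈ D₁, a ∈ E₁) (hD₂ : ∀ a ∈ D₂, a ∈ E₂)
    (hX₁ : ∀ a ∈ X₁, a ∈ P₁) (hX₂ : ∀ a ∈ X₂, a ∈ P₂)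
    (hQ₁ : (Q₁ ++ Y₁).Perm P₁) (hQ₂ : (Q₂ ++ Y₂).Perm P₂) :
    portSummand K ε E (D₁ ++ D₂) (N₁ * N₂) (X₁ ++ X₂) (Q₁ ++ Q₂) (Y₁ ++ Y₂) =
      ((ε.sgn (P₁ ++ P₂ ++ E) * ε.sgn (P₁ ++ E₁) * ε.sgn (P₂ ++ E₂) : ℤ) : K) •
        (portSummand K ε E₁ D₁ N₁ X₁ Q₁ Y₁ * portSummand K ε E₂ D₂ N₂ X₂ Q₂ Y₂) := by
  have hQ₁' : ∀ a ∈ Q₁, a ∈ P₁ := fun a ha => hQ₁.mem_iff.1 (List.mem_append_left _ ha)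
  have hQ₂' : ∀ a ∈ Q₂, a ∈ P₂ := fun a ha => hQ₂.mem_iff.1 (List.mem_append_left _ ha)
  have hc : ∀ Z₁ Z₂ : List α, (∀ a ∈ Z₁, a ∈ P₁) → (∀ a ∈ Z₂, a ∈ P₂) →
      coord (N₁ * N₂) (Z₁ ++ Z₂ ++ (D₁ ++ D₂)) =
        (-1) ^ (Z₂.length * D₁.length) * (coord N₁ (Z₁ ++ D₁) * coord N₂ (Z₂ ++ D₂)) := by
    intro Z₁ Z₂ h₁ h₂
    rw [List.append_assoc, (isAlt_coord _).swap_blocks, ← List.append_assoc,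
      coord_mul hd hN₁ hN₂]
    · simp [zsmul_eq_mul]
    · intro a ha
      rcases List.mem_append.1 ha with h | h
      · exact hS a (List.mem_append_left _ (h₁ a h))
      · exact hS a (List.mem_append_right _ (hD₁ a h))
    · intro a ha
      rcases List.mem_append.1 ha with h | h
      · exact hT a (List.mem_append_left _ (h₂ a h))
      · exact hT a (List.mem_append_right _ (hD₂ a h))
  simp only [portSummand]
  rw [hc X₁ X₂ hX₁ hX₂, hc Q₁ Q₂ hQ₁' hQ₂']
  -- If a coordinate of N₂ vanishes then both sides do; otherwise both sequences have length n.
  by_cases hz : coord N₂ (X₂ ++ D₂) = 0 ∨ coord N₂ (Q₂ ++ D₂) = 0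
  · rcases hz with hz | hz <;> simp [hz]
  push Not at hz
  have hlen : Q₂.length = X₂.length := by
    have h1 := hn _ hz.1
    have h2 := hn _ hz.2
    rw [List.length_append] at h1 h2
    omega
  have e1 : (ε.sgn (Q₁ ++ Q₂ ++ (Y₁ ++ Y₂) ++ E) : ℤ) = (-1) ^ (X₂.length * Y₁.length) *
      ε.sgn (Q₁ ++ Y₁ ++ (Q₂ ++ Y₂ ++ E)) := by
    have := ε.isAlt.swap_blocks Q₁ Q₂ Y₁ (Y₂ ++ E)
    rw [hlen] at this
    simpa using this
  have e2 : mono K ((X₁ ++ X₂).map PortedElt.iota ++ (Y₁ ++ Y₂).map .upsilon) =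
      (-1 : K) ^ (X₂.length * Y₁.length) • (mono K (X₁.map .iota ++ Y₁.map .upsilon) *
        mono K (X₂.map .iota ++ Y₂.map .upsilon)) := by
    have := (isAlt_mono (F := K)).swap_blocks (X₁.map PortedElt.iota) (X₂.map .iota)
      (Y₁.map .upsilon) (Y₂.map .upsilon)
    simp only [List.length_map] at this
    rw [← mono_append, List.map_append, List.map_append, List.append_assoc, this,
      ← Int.cast_smul_eq_zsmul K, List.append_assoc]
    simp
  -- Reordering QᵢYᵢ to Pᵢ changes ε(QᵢYᵢEᵢ) and the joint sign in the same way; values of ε on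
  -- distinct elements have square 1.
  have e3 : ε.sgn (Q₁ ++ Y₁ ++ (Q₂ ++ Y₂ ++ E)) =
      ε.sgn (P₁ ++ P₂ ++ E) * ε.sgn (P₁ ++ E₁) * ε.sgn (P₂ ++ E₂) *
        (ε.sgn (Q₁ ++ Y₁ ++ E₁) * ε.sgn (Q₂ ++ Y₂ ++ E₂)) := by
    have h1 := (ε.isAlt.append_right (Q₂ ++ Y₂ ++ E)).perm_mul (ε.isAlt.append_right E₁) hQ₁
    have h2 := ((ε.isAlt.append_right E).append_left P₁).perm_mul (ε.isAlt.append_right E₂) hQ₂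
    have h3 := ε.mul_self ((hQ₁.append_right E₁).nodup_iff.2 hn₁)
    have h4 := ε.mul_self ((hQ₂.append_right E₂).nodup_iff.2 hn₂)
    simp only [List.append_assoc] at *
    linear_combination ε.sgn (Q₁ ++ (Y₁ ++ E₁)) * h1
      + ε.sgn (Q₁ ++ (Y₁ ++ E₁)) * ε.sgn (P₁ ++ E₁) * ε.sgn (Q₂ ++ (Y₂ ++ E₂)) * h2
      - ε.sgn (Q₁ ++ (Y₁ ++ (Q₂ ++ (Y₂ ++ E)))) * h3
      - ε.sgn (P₁ ++ (Q₂ ++ (Y₂ ++ E))) * ε.sgn (Q₁ ++ (Y₁ ++ E₁)) * ε.sgn (P₁ ++ E₁) * h4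
  have hs : ∀ k : ℕ, (-1 : K) ^ k * (-1) ^ k = 1 := fun k => by rw [← mul_pow]; simp
  rw [e1, e2, e3, hlen, smul_smul, smul_mul_smul_comm, smul_smul]
  congr 1
  simp only [map_mul, map_pow, map_neg, map_one]
  push_cast
  linear_combination
    (algebraMap F K (coord N₁ (X₁ ++ D₁)) * algebraMap F K (coord N₂ (X₂ ++ D₂)) *
      (algebraMap F K (coord N₁ (Q₁ ++ D₁)) * algebraMap F K (coord N₂ (Q₂ ++ D₂))) *
      ((ε.sgn (P₁ ++ P₂ ++ E) : K) * ε.sgn (P₁ ++ E₁) * ε.sgn (P₂ ++ E₂) *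
        (ε.sgn (Q₁ ++ Y₁ ++ E₁) * ε.sgn (Q₂ ++ Y₂ ++ E₂)))) *
      ((-1 : K) ^ (X₂.length * Y₁.length) * (-1) ^ (X₂.length * Y₁.length) *
        hs (X₂.length * D₁.length) + hs (X₂.length * Y₁.length))

variable [DecidableEq α]

/-- Replacing E by E' only affects ε(QYE). Since QY is a permutation of P, the change of sign is the
same for every Q, namely ε(PE) ε(PE'). -/
theorem portSum_congr (ε : GroundSetOrientation α) {P E E' D D' : List α} {N N' : Ext F α}
    (hP : P.Nodup) (hE' : (P ++ E').Nodup)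
    (h : ∀ X : List α, (∀ a ∈ X, a ∈ P) → coord N (X ++ D) = coord N' (X ++ D')) :
    portSum K ε P E D N =
      ((ε.sgn (P ++ E) * ε.sgn (P ++ E') : ℤ) : K) • portSum K ε P E' D' N' := by
  rw [portSum, portSum, Finset.smul_sum]
  refine Finset.sum_congr rfl fun Q hQ => ?_
  rw [Finset.smul_sum]
  refine Finset.sum_congr rfl fun X hX => ?_
  have hm : ∀ {Q : Finset α}, Q ∈ P.toFinset.powerset → ∀ a ∈ Q.toList, a ∈ P := by
    intro Q hQ a ha
    simpa using Finset.mem_powerset.1 hQ (Finset.mem_toList.1 ha)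
  rw [portSummand, portSummand, h _ (hm hX), h _ (hm hQ), smul_smul]
  congr 1
  have hp : (Q.toList ++ (P.toFinset \ Q).toList).Perm P :=
    (toList_sdiff_perm (Finset.mem_powerset.1 hQ)).trans (toList_toFinset_perm hP)
  have h1 := (ε.isAlt.append_right E).perm_mul (ε.isAlt.append_right E') hp
  have h2 := ε.mul_self ((hp.append_right E').nodup_iff.2 hE')
  have h3 : ε.sgn (Q.toList ++ (P.toFinset \ Q).toList ++ E) =
      ε.sgn (P ++ E) * ε.sgn (P ++ E') * ε.sgn (Q.toList ++ (P.toFinset \ Q).toList ++ E') := by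
    rw [← h1, mul_assoc, h2, mul_one]
  rw [h3]
  push_cast
  ring

/-- The additive equation for `M_E(N)`, where `N'` has the coordinates of `N` avoiding `e`. -/
theorem extME_add (ε : GroundSetOrientation α) (g r : α → K) {P E E' : List α} {e : α}
    (hPE : (P ++ E).Nodup) (hE : E.Perm (e :: E')) {N N₁ N₂ : Ext F α}
    (hN : N ∈ groundSubmodule F (P ++ E).toFinset)
    (hN₁ : N₁ ∈ groundSubmodule F (P ++ E').toFinset)
    (hN₂ : N₂ ∈ groundSubmodule F (P ++ E').toFinset)
    (h₁ : ∀ A : List α, coord N₁ A = coord N (A ++ [e]))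
    (h₂ : ∀ A : List α, e ∉ A → coord N₂ A = coord N A) :
    extME ε g r P E N = ((ε.sgn (P ++ E) * ε.sgn (P ++ E') : ℤ) : K) •
      (g e • extME ε g r P E' N₁ + r e • extME ε g r P E' N₂) := by
  have hPe : (P ++ e :: E').Nodup := (hE.append_left P).nodup_iff.1 hPE
  have hPE' : (P ++ E').Nodup := hPe.sublist (by simp)
  have hP : P.Nodup := (List.nodup_append.1 hPE).1
  have heE : e ∉ E'.toFinset := by
    have := (List.nodup_append.1 hPe).2.1
    simpa using (List.nodup_cons.1 this).1
  have heP : e ∉ P := fun h => (List.nodup_append.1 hPe).2.2 e h e (by simp) rfl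
  have hEf : E.toFinset = insert e E'.toFinset := by
    rw [List.toFinset_eq_of_perm _ _ hE, List.toFinset_cons]
  rw [extME_eq_sum ε g r hPE hN, extME_eq_sum ε g r hPE' hN₁, extME_eq_sum ε g r hPE' hN₂, hEf,
    Finset.sum_powerset_insert heE, add_comm, smul_add, Finset.smul_sum, Finset.smul_sum,
    Finset.smul_sum, Finset.smul_sum]
  congr 1
  · refine Finset.sum_congr rfl fun D hD => ?_
    have heD : e ∉ D := fun h => heE (Finset.mem_powerset.1 hD h)
    -- The element e is listed last to match N₁[A] = N[Ae].
    have hp : (insert e D).toList.Perm (D.toList ++ [e]) := by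
      refine (Finset.toList_insert heD).trans ?_
      exact (List.perm_append_singleton e _).symm
    rw [portSum_perm ε P E hp, portSum_congr ε (D' := D.toList) (N' := N₁) hP hPE',
      Finset.prod_insert heD, Finset.insert_sdiff_insert, Finset.sdiff_insert_of_notMem heE]
    · simp only [smul_smul]
      congr 1
      ring
    · intro X _
      rw [h₁, List.append_assoc]
  · refine Finset.sum_congr rfl fun D hD => ?_
    have heD : e ∉ D := fun h => heE (Finset.mem_powerset.1 hD h)
    rw [portSum_congr ε (D' := D.toList) (N' := N₂) hP hPE', Finset.insert_sdiff_of_notMem _ heD,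
      Finset.prod_insert (by simp [heE])]
    · simp only [smul_smul]
      congr 1
      ring
    · intro X hX
      rw [h₂]
      simpa [heD] using fun h => heP (hX e h)

theorem portSum_mul (ε : GroundSetOrientation α) {P₁ E₁ P₂ E₂ : List α} {S T : Finset α}
    (hd : Disjoint S T) {N₁ N₂ : Ext F α}
    (hN₁ : N₁ ∈ groundSubmodule F S) (hN₂ : N₂ ∈ groundSubmodule F T)
    {n : ℕ} (hn : ∀ A, coord N₂ A ≠ 0 → A.length = n)
    (hS : ∀ a, a ∈ P₁ ++ E₁ → a ∈ S) (hT : ∀ a, a ∈ P₂ ++ E₂ → a ∈ T)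
    (hn₁ : (P₁ ++ E₁).Nodup) (hn₂ : (P₂ ++ E₂).Nodup) (E : List α) {D₁ D₂ : List α}
    (hD₁ : ∀ a ∈ D₁, a ∈ E₁) (hD₂ : ∀ a ∈ D₂, a ∈ E₂) :
    portSum K ε (P₁ ++ P₂) E (D₁ ++ D₂) (N₁ * N₂) =
      ((ε.sgn (P₁ ++ P₂ ++ E) * ε.sgn (P₁ ++ E₁) * ε.sgn (P₂ ++ E₂) : ℤ) : K) •
        (portSum K ε P₁ E₁ D₁ N₁ * portSum K ε P₂ E₂ D₂ N₂) := by
  have hdis : Disjoint P₁.toFinset P₂.toFinset := by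
    refine hd.mono (fun a ha => ?_) (fun a ha => ?_)
    · exact hS a (List.mem_append_left _ (List.mem_toFinset.1 ha))
    · exact hT a (List.mem_append_left _ (List.mem_toFinset.1 ha))
  have hnP₁ := (List.nodup_append.1 hn₁).1
  have hnP₂ := (List.nodup_append.1 hn₂).1
  simp only [portSum, List.toFinset_append]
  rw [sum_powerset_union hdis]
  simp only [sum_powerset_union hdis]
  simp only [Finset.sum_mul_sum, Finset.smul_sum]
  refine Finset.sum_congr rfl fun Q₁ hQ₁ => Finset.sum_congr rfl fun Q₂ hQ₂ =>
    Finset.sum_congr rfl fun X₁ hX₁ => Finset.sum_congr rfl fun X₂ hX₂ => ?_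
  rw [Finset.mem_powerset] at hQ₁ hQ₂ hX₁ hX₂
  have hY : (P₁.toFinset ∪ P₂.toFinset) \ (Q₁ ∪ Q₂) =
      (P₁.toFinset \ Q₁) ∪ (P₂.toFinset \ Q₂) := by
    have := Finset.disjoint_left.1 hdis
    ext a
    have h1 := @hQ₁ a
    have h2 := @hQ₂ a
    have h3 := @this a
    simp only [Finset.mem_sdiff, Finset.mem_union]
    tauto
  rw [hY, portSummand_perm ε E (D₁ ++ D₂) (N₁ * N₂) (toList_union_perm (hdis.mono hX₁ hX₂))
    (toList_union_perm (hdis.mono hQ₁ hQ₂))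
    (toList_union_perm (hdis.mono Finset.sdiff_subset Finset.sdiff_subset)),
    portSummand_mul ε hd hN₁ hN₂ hn hS hT hn₁ hn₂ hD₁ hD₂]
  · intro a ha; simpa using hX₁ (Finset.mem_toList.1 ha)
  · intro a ha; simpa using hX₂ (Finset.mem_toList.1 ha)
  · exact (toList_sdiff_perm hQ₁).trans (toList_toFinset_perm hnP₁)
  · exact (toList_sdiff_perm hQ₂).trans (toList_toFinset_perm hnP₂)

/-- The multiplicative equation for `M_E(N)`. -/
theorem extME_mul (ε : GroundSetOrientation α) (g r : α → K) {P₁ E₁ P₂ E₂ E : List α}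
    (hn₁ : (P₁ ++ E₁).Nodup) (hn₂ : (P₂ ++ E₂).Nodup)
    (hd : Disjoint (P₁ ++ E₁).toFinset (P₂ ++ E₂).toFinset) (hE : E.Perm (E₁ ++ E₂))
    {N₁ N₂ : Ext F α}
    (hN₁ : N₁ ∈ groundSubmodule F (P₁ ++ E₁).toFinset)
    (hN₂ : N₂ ∈ groundSubmodule F (P₂ ++ E₂).toFinset)
    (hN : N₁ * N₂ ∈ groundSubmodule F (P₁ ++ P₂ ++ E).toFinset)
    {n : ℕ} (hn : ∀ A, coord N₂ A ≠ 0 → A.length = n) :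
    extME ε g r (P₁ ++ P₂) E (N₁ * N₂) =
      ((ε.sgn (P₁ ++ P₂ ++ E) * ε.sgn (P₁ ++ E₁) * ε.sgn (P₂ ++ E₂) : ℤ) : K) •
        (extME ε g r P₁ E₁ N₁ * extME ε g r P₂ E₂ N₂) := by
  have hEf : E.toFinset = E₁.toFinset ∪ E₂.toFinset := by
    rw [List.toFinset_eq_of_perm _ _ hE, List.toFinset_append]
  have hdE : Disjoint E₁.toFinset E₂.toFinset := by
    simp only [List.toFinset_append] at hd
    exact hd.mono Finset.subset_union_right Finset.subset_union_right
  have hnPE : (P₁ ++ P₂ ++ E).Nodup := by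
    have h1 : ((P₁ ++ E₁) ++ (P₂ ++ E₂)).Nodup :=
      List.nodup_append'.2 ⟨hn₁, hn₂, List.disjoint_toFinset_iff_disjoint.1 hd⟩
    refine List.Perm.nodup_iff ?_ |>.1 h1
    rw [List.append_assoc, List.append_assoc]
    refine List.Perm.append_left _ ?_
    refine (List.perm_append_comm_assoc _ _ _).trans ?_
    exact hE.symm.append_left _
  rw [extME_eq_sum ε g r hnPE hN, extME_eq_sum ε g r hn₁ hN₁, extME_eq_sum ε g r hn₂ hN₂, hEf,
    sum_powerset_union hdE]
  simp only [Finset.sum_mul_sum, Finset.smul_sum]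
  refine Finset.sum_congr rfl fun D₁ hD₁ => Finset.sum_congr rfl fun D₂ hD₂ => ?_
  rw [Finset.mem_powerset] at hD₁ hD₂
  have hR : (E₁.toFinset ∪ E₂.toFinset) \ (D₁ ∪ D₂) =
      (E₁.toFinset \ D₁) ∪ (E₂.toFinset \ D₂) := by
    have := Finset.disjoint_left.1 hdE
    ext a
    have h1 := @hD₁ a
    have h2 := @hD₂ a
    have h3 := @this a
    simp only [Finset.mem_sdiff, Finset.mem_union]
    tauto
  rw [hR, Finset.prod_union (hdE.mono hD₁ hD₂),
    Finset.prod_union (hdE.mono Finset.sdiff_subset Finset.sdiff_subset),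
    portSum_perm ε _ _ (toList_union_perm (hdE.mono hD₁ hD₂)),
    portSum_mul ε hd hN₁ hN₂ hn (by simp) (by simp) hn₁ hn₂ E
      (fun a ha => by simpa using hD₁ (Finset.mem_toList.1 ha))
      (fun a ha => by simpa using hD₂ (Finset.mem_toList.1 ha)), smul_mul_smul_comm, smul_smul,
    smul_smul]
  congr 1
  ring

/-- `M_E(N)` in the absence of ports. -/
theorem extME_nil (ε : GroundSetOrientation α) (g r : α → K) {E : List α} (hE : E.Nodup)
    {N : Ext F α} (hN : N ∈ groundSubmodule F E.toFinset) :
    extME ε g r [] E N = algebraMap K (Ext K (PortedElt α)) ((ε.sgn E : K) *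
      ∑ D ∈ E.toFinset.powerset, algebraMap F K (coord N D.toList * coord N D.toList) *
        ((∏ e ∈ D, g e) * ∏ e ∈ E.toFinset \ D, r e)) := by
  rw [extME_eq_sum ε g r (by simpa using hE) (by simpa using hN), Algebra.algebraMap_eq_smul_one,
    Finset.mul_sum, Finset.sum_smul]
  refine Finset.sum_congr rfl fun D _ => ?_
  simp only [portSum, List.toFinset_nil, Finset.powerset_empty, Finset.sum_singleton, portSummand,
    Finset.toList_empty, List.nil_append, Finset.sdiff_empty, List.map_nil, mono_nil, smul_smul]
  congr 1
  ring

end Equations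

/-! ### Extensors -/

section Factorization

variable {F α : Type*} [Field F]

/-- The product of a list of vectors in the exterior algebra. -/
def wedge (vs : List (α →₀ F)) : Ext F α := (vs.map (ExteriorAlgebra.ι F)).prod

theorem wedge_nil : wedge ([] : List (α →₀ F)) = 1 := rfl

theorem wedge_cons (v : α →₀ F) (vs : List (α →₀ F)) :
    wedge (v :: vs) = ExteriorAlgebra.ι F v * wedge vs := by simp [wedge]

theorem wedge_append (us vs : List (α →₀ F)) : wedge (us ++ vs) = wedge us * wedge vs := by
  simp [wedge]

theorem wedge_concat (vs : List (α →₀ F)) (v : α →₀ F) :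
    wedge (vs ++ [v]) = wedge vs * ExteriorAlgebra.ι F v := by simp [wedge]

/-- The span of a list of vectors. -/
abbrev spanList (vs : List (α →₀ F)) : Submodule F (α →₀ F) := Submodule.span F {v | v ∈ vs}

/-- Interior multiplication on the right by a functional. -/
abbrev contractDual (N : Ext F α) (d : Module.Dual F (α →₀ F)) : Ext F α :=
  CliffordAlgebra.contractRight (Q := (0 : QuadraticForm F (α →₀ F))) N d

theorem ι_mul_wedge (w : α →₀ F) (l : List (α →₀ F)) :
    ExteriorAlgebra.ι F w * wedge l = (-1 : F) ^ l.length • (wedge l * ExteriorAlgebra.ι F w) := by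
  induction l with
  | nil => simp [wedge_nil]
  | cons v l ih =>
    have h := eq_neg_of_add_eq_zero_left (ExteriorAlgebra.ι_add_mul_swap (R := F) w v)
    rw [wedge_cons, ← mul_assoc, h, neg_mul, mul_assoc, ih, mul_smul_comm, ← mul_assoc,
      List.length_cons, pow_succ]
    simp

/-- Multiples of w in the other factors are annihilated by the final factor w. -/
theorem wedge_mul_ι_eq (w : α →₀ F) (k : (α →₀ F) → F) (l : List (α →₀ F)) :
    wedge l * ExteriorAlgebra.ι F w =
      wedge (l.map fun v => v - k v • w) * ExteriorAlgebra.ι F w := by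
  induction l with
  | nil => rfl
  | cons v l ih =>
    have h0 : ExteriorAlgebra.ι F w * (wedge (l.map fun v => v - k v • w) *
        ExteriorAlgebra.ι F w) = 0 := by
      rw [← mul_assoc, ι_mul_wedge, smul_mul_assoc, mul_assoc, ExteriorAlgebra.ι_sq_zero]
      simp
    rw [List.map_cons, wedge_cons, wedge_cons, mul_assoc, mul_assoc, ih, map_sub, map_smul,
      sub_mul, smul_mul_assoc, h0, smul_zero, sub_zero]

theorem contractDual_mul_ι (x : Ext F α) (v : α →₀ F) (d : Module.Dual F (α →₀ F)) :
    contractDual (x * ExteriorAlgebra.ι F v) d =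
      d v • x - contractDual x d * ExteriorAlgebra.ι F v :=
  CliffordAlgebra.contractRight_mul_ι (Q := (0 : QuadraticForm F (α →₀ F))) d v x

theorem contractDual_wedge_eq_zero {d : Module.Dual F (α →₀ F)} {vs : List (α →₀ F)}
    (h : ∀ v ∈ vs, d v = 0) : contractDual (wedge vs) d = 0 := by
  induction vs using List.reverseRecOn with
  | nil => exact CliffordAlgebra.contractRight_one (Q := (0 : QuadraticForm F (α →₀ F))) _
  | append_singleton vs v ih =>
    rw [wedge_concat, contractDual_mul_ι, ih fun u hu => h u (by simp [hu]), h v (by simp)]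
    simp

/-- Interior multiplication of a product of vectors by a functional that does not vanish on
all of them: the factors of the result span the hyperplane where the functional vanishes. -/
theorem exists_contractDual_wedge {d : Module.Dual F (α →₀ F)} {vs : List (α →₀ F)} {w : α →₀ F}
    (hw : w ∈ vs) (hd : d w ≠ 0) :
    ∃ c : F, c ≠ 0 ∧ ∃ us : List (α →₀ F), contractDual (wedge vs) d = c • wedge us ∧
      (wedge vs ≠ 0 → wedge us ≠ 0) ∧
      ∀ f, f ∈ spanList us ↔ f ∈ spanList vs ∧ d f = 0 := by
  obtain ⟨l₁, l₂, rfl⟩ := List.append_of_mem hw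
  -- The other factors are projected along w into the kernel of d; the product is then ± us · w, and
  -- contraction leaves the multiple d(w) of us.
  set us := (l₁ ++ l₂).map fun v => v - (d v / d w) • w with hus
  have hprod : wedge (l₁ ++ w :: l₂) =
      (-1 : F) ^ l₂.length • (wedge us * ExteriorAlgebra.ι F w) := by
    rw [hus, ← wedge_mul_ι_eq w fun v => d v / d w]
    rw [wedge_append, wedge_cons, ι_mul_wedge, mul_smul_comm, wedge_append, mul_assoc]
  have hdus : ∀ v ∈ us, d v = 0 := by
    intro v hv
    obtain ⟨u, -, rfl⟩ := List.mem_map.1 hv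
    simp [hd]
  refine ⟨(-1) ^ l₂.length * d w, mul_ne_zero (pow_ne_zero _ (by simp)) hd, us, ?_, ?_, ?_⟩
  · rw [hprod, contractDual, map_smul, LinearMap.smul_apply]
    have := contractDual_mul_ι (wedge us) w d
    rw [contractDual_wedge_eq_zero hdus, zero_mul, sub_zero] at this
    rw [mul_smul]
    exact congrArg _ this
  · intro h h'
    rw [hprod, h'] at h
    simp at h
  · intro f
    constructor
    · intro hf
      refine ⟨?_, ?_⟩
      · refine (Submodule.span_le.2 ?_ : spanList us ≤ _) hf
        intro v hv
        obtain ⟨u, hu, rfl⟩ := List.mem_map.1 hv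
        refine Submodule.sub_mem _ (Submodule.subset_span ?_)
          (Submodule.smul_mem _ _ (Submodule.subset_span ?_))
        · rcases List.mem_append.1 hu with h | h <;> simp [h]
        · simp
      · exact (Submodule.span_le.2 hdus : spanList us ≤ LinearMap.ker d) hf
    · rintro ⟨hf, hf0⟩
      -- The projection along w onto the kernel of d maps the whole span into the span of us, and
      -- fixes f when d f = 0.
      have key : ∀ f ∈ spanList (l₁ ++ w :: l₂), f - (d f / d w) • w ∈ spanList us := by
        intro f hf
        induction hf using Submodule.span_induction with
        | mem v hv =>
          by_cases hvw : v = w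
          · subst hvw
            simp [hd]
          · refine Submodule.subset_span (List.mem_map.2 ⟨v, ?_, rfl⟩)
            simpa [hvw] using hv
        | zero => simp
        | add x y _ _ hx hy =>
          have := Submodule.add_mem _ hx hy
          rw [map_add, add_div, add_smul]
          convert this using 1
          abel
        | smul c x _ hx =>
          have := Submodule.smul_mem _ c hx
          rw [map_smul, smul_eq_mul, mul_div_assoc, mul_smul]
          rwa [smul_sub] at this
      simpa [hf0] using key f hf

theorem eq_zero_of_mem_spanList {vs : List (α →₀ F)} {S : Finset α}
    (h : ∀ v ∈ vs, ∀ a ∉ S, v a = 0) {f : α →₀ F} (hf : f ∈ spanList vs) {a : α} (ha : a ∉ S) :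
    f a = 0 :=
  (Submodule.span_le.2 fun v hv => h v hv a ha :
    spanList vs ≤ LinearMap.ker (Finsupp.lapply a)) hf

theorem IsExtensor.zero (S : Finset α) : IsExtensor S (0 : Ext F α) :=
  ⟨0, [], by simp, by simp⟩

theorem IsExtensor.mem_groundSubmodule {S : Finset α} {N : Ext F α} (h : IsExtensor S N) :
    N ∈ groundSubmodule F S := by
  obtain ⟨c, vs, h⟩ := h
  exact h.mem_groundSubmodule

theorem IsExtensor.mono_mem {S : Finset α} {A : List α} (h : ∀ a ∈ A, a ∈ S) :
    IsExtensor S (mono F A) := by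
  refine ⟨1, A.map fun a => Finsupp.single a 1, ?_, ?_⟩
  · intro v hv a ha
    obtain ⟨b, hb, rfl⟩ := List.mem_map.1 hv
    rw [Finsupp.single_eq_of_ne]
    rintro rfl
    exact ha (h _ hb)
  · rw [one_smul, List.map_map]
    rfl

theorem IsExtensor.smul {S : Finset α} {N : Ext F α} (h : IsExtensor S N) (k : F) :
    IsExtensor S (k • N) := by
  obtain ⟨c, vs, h, rfl⟩ := h
  exact ⟨k * c, vs, h, by rw [mul_smul]⟩

theorem IsFactorization.mul [DecidableEq α] {S T : Finset α} {N N' : Ext F α} {c c' : F}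
    {vs vs' : List (α →₀ F)} (h : IsFactorization S N c vs) (h' : IsFactorization T N' c' vs') :
    IsFactorization (S ∪ T) (N * N') (c * c') (vs ++ vs') := by
  refine ⟨fun v hv a ha => ?_, ?_⟩
  · simp only [Finset.mem_union, not_or] at ha
    rcases List.mem_append.1 hv with hv | hv
    · exact h.1 v hv a ha.1
    · exact h'.1 v hv a ha.2
  · rw [h.2, h'.2, smul_mul_smul_comm, List.map_append, List.prod_append]

theorem IsExtensor.mul [DecidableEq α] {S T : Finset α} {N N' : Ext F α} (h : IsExtensor S N)
    (h' : IsExtensor T N') : IsExtensor (S ∪ T) (N * N') := by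
  obtain ⟨c, vs, h⟩ := h
  obtain ⟨c', vs', h'⟩ := h'
  exact ⟨_, _, h.mul h'⟩

/-- Besides decomposability, this records that the new factors are killed by d; for the coordinate
functional at e this removes e from the ground set. -/
theorem IsExtensor.exists_contractDual {S : Finset α} {N : Ext F α} (h : IsExtensor S N)
    (d : Module.Dual F (α →₀ F)) : ∃ (c : F) (us : List (α →₀ F)),
      (∀ v ∈ us, (∀ a ∉ S, v a = 0) ∧ d v = 0) ∧
      contractDual N d = c • wedge us := by
  obtain ⟨c, vs, h, hN⟩ := h
  obtain rfl : N = c • wedge vs := hN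
  have hc : PortedTutte.contractDual (c • wedge vs) d =
      c • PortedTutte.contractDual (wedge vs) d := by
    rw [PortedTutte.contractDual, map_smul, LinearMap.smul_apply]
  by_cases h0 : ∀ v ∈ vs, d v = 0
  · exact ⟨0, [], by simp, by rw [hc, contractDual_wedge_eq_zero h0]; simp⟩
  · push Not at h0
    obtain ⟨w, hw, hd⟩ := h0
    obtain ⟨k, -, us, hk, -, hus⟩ := exists_contractDual_wedge hw hd
    refine ⟨c * k, us, fun v hv => ?_, by rw [hc, hk, mul_smul]⟩
    have := (hus v).1 (Submodule.subset_span hv)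
    exact ⟨fun a ha => eq_zero_of_mem_spanList h this.1 ha, this.2⟩

theorem IsExtensor.contract [DecidableEq α] {S : Finset α} {N : Ext F α} (h : IsExtensor S N)
    (e : α) : IsExtensor (S.erase e) (contract N e) := by
  obtain ⟨c, us, hus, heq⟩ := IsExtensor.exists_contractDual h (Finsupp.lapply e)
  refine ⟨c, us, fun v hv a ha => ?_, heq⟩
  by_cases hae : a = e
  · subst hae
    exact (hus v hv).2
  · exact (hus v hv).1 a fun h => ha (Finset.mem_erase.2 ⟨hae, h⟩)

theorem IsExtensor.contractList [DecidableEq α] {S : Finset α} {N : Ext F α} (h : IsExtensor S N)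
    (A : List α) : IsExtensor (S \ A.toFinset) (contractList N A) := by
  induction A with
  | nil => simpa [PortedTutte.contractList] using h
  | cons e A ih =>
    have := ih.contract e
    rwa [← Finset.sdiff_insert, ← List.toFinset_cons] at this

theorem IsExtensor.reverse {S : Finset α} {N : Ext F α} (h : IsExtensor S N) :
    IsExtensor S (CliffordAlgebra.reverse N) := by
  obtain ⟨c, vs, h, rfl⟩ := h
  refine ⟨c, vs.reverse, by simpa using h, ?_⟩
  rw [map_smul]
  have := CliffordAlgebra.reverse_prod_map_ι (Q := (0 : QuadraticForm F (α →₀ F))) vs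
  rw [List.map_reverse]
  exact congrArg _ this

/-- Reversal exchanges left and right contraction and preserves extensors. -/
theorem IsExtensor.contractLeft {S : Finset α} {N : Ext F α} (h : IsExtensor S N)
    (d : Module.Dual F (α →₀ F)) :
    IsExtensor S (CliffordAlgebra.contractLeft (Q := (0 : QuadraticForm F (α →₀ F))) d N) := by
  obtain ⟨c, us, hus, heq⟩ := IsExtensor.exists_contractDual h.reverse d
  have h2 : IsExtensor S (PortedTutte.contractDual (CliffordAlgebra.reverse N) d) :=
    ⟨c, us, fun v hv => (hus v hv).1, heq⟩
  have h3 := h2.reverse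
  have h4 := CliffordAlgebra.contractRight_eq (Q := (0 : QuadraticForm F (α →₀ F))) d
    (CliffordAlgebra.reverse N)
  rw [CliffordAlgebra.reverse_reverse] at h4
  rwa [PortedTutte.contractDual, h4, CliffordAlgebra.reverse_reverse] at h3

theorem contractLeft_mono_of_notMem {e : α} {C : List α} (h : e ∉ C) :
    CliffordAlgebra.contractLeft (Q := (0 : QuadraticForm F (α →₀ F))) (Finsupp.lapply e)
      (mono F C) = 0 := by
  induction C with
  | nil => exact CliffordAlgebra.contractLeft_one (Q := (0 : QuadraticForm F (α →₀ F))) _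
  | cons a C ih =>
    simp only [List.mem_cons, not_or] at h
    have := CliffordAlgebra.contractLeft_ι_mul (Q := (0 : QuadraticForm F (α →₀ F)))
      (Finsupp.lapply e) (Finsupp.single a 1) (mono F C)
    rw [ih h.2] at this
    rw [mono_cons]
    refine this.trans ?_
    simp [Ne.symm h.1]

end Factorization

/-! ### The canonical dual of an extensor -/

section Dual

variable {F α : Type*} [Field F] [DecidableEq α]

/-- The canonical dual, as a linear map. -/
def dualLin (F : Type*) {α : Type*} [Field F] [DecidableEq α] (ε : GroundSetOrientation α)
    (S : Finset α) : Ext F α →ₗ[F] Ext F α :=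
  ∑ X ∈ S.powerset, ((ε.sgn ((S \ X).toList ++ X.toList) : F) •
    coordLin F (S \ X).toList).smulRight (mono F X.toList)

theorem dualLin_apply (ε : GroundSetOrientation α) (S : Finset α) (N : Ext F α) :
    dualLin F ε S N = dual ε S N := by
  simp [dualLin, dual, LinearMap.sum_apply, coordLin_apply, mul_comm]

theorem dual_mono (ε : GroundSetOrientation α) {S : Finset α} {A C : List α}
    (hn : (A ++ C).Nodup) (hS : (A ++ C).toFinset = S) :
    dual ε S (mono F A) = (ε.sgn (A ++ C) : F) • mono F C := by
  have hA := (List.nodup_append.1 hn).1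
  have hC := (List.nodup_append.1 hn).2.1
  have hdis : Disjoint A.toFinset C.toFinset :=
    List.disjoint_toFinset_iff_disjoint.2 (List.disjoint_of_nodup_append hn)
  rw [List.toFinset_append] at hS
  have hSC : S \ C.toFinset = A.toFinset := by
    rw [← hS, Finset.union_sdiff_cancel_right hdis]
  rw [dual, Finset.sum_eq_single C.toFinset]
  · rw [hSC]
    have h1 := coord_mono_smul (F := F) ((ε.isAlt_cast F).append_right C.toFinset.toList)
      (toList_toFinset_perm hA)
    have h2 := ((ε.isAlt_cast F).append_left A).perm_smul (isAlt_mono (F := F))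
      (toList_toFinset_perm hC)
    rw [smul_eq_mul] at h1
    rw [h1, h2]
  · intro X hX hne
    rw [coord_mono_of_not_perm, zero_mul, zero_smul]
    intro hp
    apply hne
    have h1 : S \ X = A.toFinset := by
      rw [← List.toFinset_eq_of_perm _ _ hp, Finset.toList_toFinset]
    rw [← Finset.sdiff_sdiff_eq_self (Finset.mem_powerset.1 hX), h1, ← hS,
      Finset.union_sdiff_cancel_left hdis]
  · intro h
    exact absurd (Finset.mem_powerset.2 (hS ▸ Finset.subset_union_right)) h

theorem dual_one (ε : GroundSetOrientation α) (S : Finset α) :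
    dual ε S (1 : Ext F α) = (ε.sgn S.toList : F) • mono F S.toList :=
  dual_mono ε (A := []) (C := S.toList) S.nodup_toList (Finset.toList_toFinset S)

/-- If e is a new letter, list the complement of A as eC. Then ε(AeC) is the sign in both duals, and
left contraction turns the monomial eC into C. If e is in A, or A has a repetition, both sides
vanish. -/
theorem dual_mono_mul_vec (ε : GroundSetOrientation α) {S : Finset α} {A : List α}
    (hA : ∀ a ∈ A, a ∈ S) {e : α} (he : e ∈ S) :
    dual ε S (mono F A * vec F e) =
      CliffordAlgebra.contractLeft (Q := (0 : QuadraticForm F (α →₀ F))) (Finsupp.lapply e)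
        (dual ε S (mono F A)) := by
  have hAe : mono F A * vec F e = mono F (A ++ [e]) := by simp [mono]
  have hsub : A.toFinset ⊆ S := fun a ha => hA a (List.mem_toFinset.1 ha)
  rw [hAe]
  by_cases hn : A.Nodup
  · by_cases heA : e ∈ A
    · rw [isAlt_mono.eq_zero (L := A ++ [e])]
      · have hd : (A ++ (S \ A.toFinset).toList).Nodup := by
          refine List.nodup_append'.2 ⟨hn, Finset.nodup_toList _, fun a ha ha' => ?_⟩
          simp [ha] at ha'
        rw [dual_mono ε hd, map_smul, contractLeft_mono_of_notMem (by simp [heA]),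
          ← dualLin_apply, map_zero, smul_zero]
        rw [List.toFinset_append, Finset.toList_toFinset, Finset.union_sdiff_of_subset hsub]
      · intro h
        exact (List.nodup_append.1 h).2.2 e heA e (by simp) rfl
    · have hd : (A ++ e :: ((S \ A.toFinset).erase e).toList).Nodup := by
        refine List.nodup_append'.2 ⟨hn, List.nodup_cons.2 ⟨by simp, Finset.nodup_toList _⟩, ?_⟩
        intro a ha ha'
        rcases List.mem_cons.1 ha' with rfl | ha'
        · exact heA ha
        · simp [ha] at ha'
      have hS : (A ++ e :: ((S \ A.toFinset).erase e).toList).toFinset = S := by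
        rw [List.toFinset_append, List.toFinset_cons, Finset.toList_toFinset, Finset.insert_erase,
          Finset.union_sdiff_of_subset hsub]
        simp [he, heA]
      have h2 : A ++ e :: ((S \ A.toFinset).erase e).toList =
        (A ++ [e]) ++ ((S \ A.toFinset).erase e).toList := by simp
      rw [dual_mono ε hd hS, map_smul]
      rw [h2] at hd hS ⊢
      rw [dual_mono ε hd hS, mono_cons]
      have := CliffordAlgebra.contractLeft_ι_mul (Q := (0 : QuadraticForm F (α →₀ F)))
        (Finsupp.lapply e) (Finsupp.single e 1) (mono F ((S \ A.toFinset).erase e).toList)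
      rw [contractLeft_mono_of_notMem (by simp)] at this
      refine congrArg _ (Eq.trans ?_ this.symm)
      simp
  · rw [isAlt_mono.eq_zero hn, isAlt_mono.eq_zero (L := A ++ [e])]
    · simp [← dualLin_apply]
    · exact fun h => hn (List.nodup_append.1 h).1

theorem dual_mul_ι (ε : GroundSetOrientation α) {S : Finset α} {N : Ext F α}
    (hN : N ∈ groundSubmodule F S) {v : α →₀ F} (hv : ∀ a ∉ S, v a = 0) :
    dual ε S (N * ExteriorAlgebra.ι F v) =
      CliffordAlgebra.contractLeft (Q := (0 : QuadraticForm F (α →₀ F)))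
        (∑ a ∈ S, v a • Finsupp.lapply a) (dual ε S N) := by
  have key : ∀ e ∈ S, dual ε S (N * vec F e) =
      CliffordAlgebra.contractLeft (Q := (0 : QuadraticForm F (α →₀ F))) (Finsupp.lapply e)
        (dual ε S N) := by
    intro e he
    induction hN using Submodule.span_induction with
    | mem x hx =>
      obtain ⟨A, hA, rfl⟩ := hx
      exact dual_mono_mul_vec ε hA he
    | zero => simp [← dualLin_apply]
    | add x y _ _ hx hy =>
      simp only [← dualLin_apply, add_mul, map_add] at *
      rw [hx, hy]
    | smul c x _ hx =>
      simp only [← dualLin_apply, smul_mul_assoc, map_smul] at *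
      rw [hx]
  rw [ι_eq_sum hv, Finset.mul_sum, ← dualLin_apply, map_sum, map_sum, LinearMap.sum_apply]
  refine Finset.sum_congr rfl fun e he => ?_
  rw [mul_smul_comm, map_smul, map_smul, LinearMap.smul_apply, dualLin_apply, key e he]

/-- The dual of 1 is a multiple of the monomial of S, and by `dual_mul_ι` each further factor of N
contracts it by one more functional. -/
theorem IsExtensor.dual (ε : GroundSetOrientation α) {S : Finset α} {N : Ext F α}
    (h : IsExtensor S N) : IsExtensor S (dual ε S N) := by
  obtain ⟨c, vs, h, rfl⟩ := h
  rw [← dualLin_apply, map_smul, dualLin_apply]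
  refine IsExtensor.smul ?_ c
  change IsExtensor S (PortedTutte.dual ε S (wedge vs))
  induction vs using List.reverseRecOn with
  | nil =>
    have := ((IsExtensor.mono_mem (F := F) (S := S) (A := S.toList) (by simp)).smul
      (ε.sgn S.toList : F))
    rw [← dual_one] at this
    exact this
  | append_singleton vs v ih =>
    have hvs : ∀ u ∈ vs, ∀ a ∉ S, u a = 0 := fun u hu => h u (by simp [hu])
    rw [wedge_concat, dual_mul_ι ε (N := wedge vs) (prod_ι_mem_groundSubmodule hvs) (h v (by simp))]
    exact (ih hvs).contractLeft _

end Dual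

/-! ### The values of `M_E` are extensors -/

section Values

variable {F K α : Type*} [Field F] [Field K] [Algebra F K] [DecidableEq α]

theorem IsExtensor.substHom {S : Finset α} {T : Finset (PortedElt α)} (copy : α → PortedElt α)
    (w : α → K) (P : List α) {N : Ext F α} (h : IsExtensor S N)
    (h₁ : ∀ a ∈ S, a ∈ P → copy a ∈ T) (h₂ : ∀ a ∈ S, a ∉ P → .elem a ∈ T) :
    IsExtensor T (substHom F copy w P N) := by
  obtain ⟨c, vs, h, rfl⟩ := h
  let f : (α →₀ F) →ₗ[F] (PortedElt α →₀ K) := Finsupp.linearCombination F fun a : α =>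
    if a ∈ P then Finsupp.single (copy a) (1 : K) else Finsupp.single (.elem a) (w a)
  have hf : ∀ v : α →₀ F, PortedTutte.substHom F copy w P (ExteriorAlgebra.ι F v) =
      ExteriorAlgebra.ι K (f v) := fun v => ExteriorAlgebra.lift_ι_apply F _ _ v
  refine ⟨algebraMap F K c, vs.map f, fun v hv x hx => ?_, ?_⟩
  · obtain ⟨u, hu, rfl⟩ := List.mem_map.1 hv
    simp only [f, Finsupp.linearCombination_apply, Finsupp.sum, Finsupp.coe_finsetSum,
      Finset.sum_apply]
    refine Finset.sum_eq_zero fun a ha => ?_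
    have haS : a ∈ S := by
      by_contra hc
      exact Finsupp.mem_support_iff.1 ha (h u hu a hc)
    rw [Finsupp.smul_apply]
    split_ifs with haP
    · rw [Finsupp.single_eq_of_ne, smul_zero]
      rintro rfl
      exact hx (h₁ a haS haP)
    · rw [Finsupp.single_eq_of_ne, smul_zero]
      rintro rfl
      exact hx (h₂ a haS haP)
  · rw [map_smul, algebraMap_smul, map_list_prod, List.map_map, List.map_map]
    congr 3
    funext v
    exact hf v

theorem IsExtensor.extME (ε : GroundSetOrientation α) (g r : α → K) {P E : List α}
    {N : Ext F α} (h : IsExtensor (P ++ E).toFinset N) :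
    IsExtensor (portCopies P) (extME ε g r P E N) := by
  let T := portCopies P ∪ (E.map PortedElt.elem).toFinset
  have hE : ∀ a ∈ (P ++ E).toFinset, a ∉ P → PortedElt.elem a ∈ T := by
    intro a ha haP
    have : a ∈ E := by simpa [haP] using ha
    simp [T, this]
  have h1 : IsExtensor T (PortedTutte.substHom F .iota g P N) :=
    h.substHom .iota g P (fun a _ ha => by simp [T, portCopies, ha]) hE
  have h2 : IsExtensor T (PortedTutte.substHom F .upsilon r P
      (PortedTutte.dual ε (P ++ E).toFinset N)) :=
    (h.dual ε).substHom .upsilon r P (fun a _ ha => by simp [T, portCopies, ha]) hE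
  have h3 := (h1.mul h2).contractList (E.map .elem)
  rw [Finset.union_self] at h3
  have h4 : T \ (E.map PortedElt.elem).toFinset = portCopies P := by
    refine Finset.union_sdiff_cancel_right (Finset.disjoint_left.2 fun x hx hx' => ?_)
    obtain ⟨e, -, rfl⟩ := List.mem_map.1 (List.mem_toFinset.1 hx')
    simp [portCopies] at hx
  rwa [h4] at h3

/-- Both N and its dual change sign. This is what makes M_E independent of the choice between the
two unimodular presentations. -/
theorem extME_neg (ε : GroundSetOrientation α) (g r : α → K) (P E : List α) (N : Ext F α) :
    extME ε g r P E (-N) = extME ε g r P E N := by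
  rw [extME, extME, extM, extM, ← dualLin_apply, ← dualLin_apply, map_neg, map_neg, map_neg,
    neg_mul_neg]

end Values

/-! ### Plücker coordinates and the span of the factors -/

section Span

variable {F α : Type*} [Field F]

theorem wedge_eq_ιMulti (vs : List (α →₀ F)) :
    wedge vs = ExteriorAlgebra.ιMulti F vs.length vs.get := by
  rw [ExteriorAlgebra.ιMulti_apply, wedge]
  congr 1
  conv_lhs => rw [← List.ofFn_get vs, List.map_ofFn]
  rfl

theorem wedge_ofFn {n : ℕ} (v : Fin n → α →₀ F) :
    wedge (List.ofFn v) = ExteriorAlgebra.ιMulti F n v := by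
  rw [ExteriorAlgebra.ιMulti_apply, wedge, List.map_ofFn]
  rfl

theorem spanList_eq (vs : List (α →₀ F)) :
    spanList vs = Submodule.span F (Set.range vs.get) := by
  rw [spanList, Set.range_list_get]

theorem linearIndependent_of_wedge_ne_zero {vs : List (α →₀ F)} (h : wedge vs ≠ 0) :
    LinearIndependent F vs.get := by
  by_contra hc
  apply h
  rw [wedge_eq_ιMulti]
  exact AlternatingMap.map_linearDependent _ _ hc

/-- A left inverse of the map sending the standard basis to v, followed by the determinant, is an
alternating form with value 1 at v. -/
theorem ιMulti_ne_zero {n : ℕ} {v : Fin n → α →₀ F} (h : LinearIndependent F v) :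
    ExteriorAlgebra.ιMulti F n v ≠ 0 := by
  obtain ⟨p, hp⟩ := LinearMap.exists_leftInverse_of_injective (Finsupp.linearCombination F v)
    (LinearMap.ker_eq_bot.2 h)
  let d : (α →₀ F) [⋀^Fin n]→ₗ[F] F :=
    (Matrix.detRowAlternating (n := Fin n) (R := F)).compLinearMap
      ((Finsupp.linearEquivFunOnFinite F F (Fin n)).toLinearMap ∘ₗ p)
  have hd : d v = 1 := by
    have hv : ∀ i, p (v i) = Finsupp.single i 1 := by
      intro i
      have := LinearMap.congr_fun hp (Finsupp.single i 1)
      simpa using this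
    have : (fun i => ((Finsupp.linearEquivFunOnFinite F F (Fin n)).toLinearMap ∘ₗ p) (v i)) =
        (1 : Matrix (Fin n) (Fin n) F) := by
      ext i j
      simp [hv, Matrix.one_apply, Finsupp.single_apply]
    change Matrix.det (fun i =>
      ((Finsupp.linearEquivFunOnFinite F F (Fin n)).toLinearMap ∘ₗ p) (v i)) = 1
    rw [this, Matrix.det_one]
  intro h0
  have := ExteriorAlgebra.liftAlternating_apply_ιMulti (R := F)
    (Function.update (fun _ => 0) n d) v
  rw [h0, map_zero, Function.update_self, hd] at this
  exact zero_ne_one this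

theorem wedge_map_ne_zero {vs : List (α →₀ F)} (h : wedge vs ≠ 0) (p : (α →₀ F) →ₗ[F] (α →₀ F))
    (hp : ∀ f ∈ spanList vs, p f = 0 → f = 0) : wedge (vs.map p) ≠ 0 := by
  have hli := (linearIndependent_of_wedge_ne_zero h).map (f := p) (by
    rw [Submodule.disjoint_def, ← spanList_eq]
    exact fun f hf hf' => hp f hf hf')
  have := ιMulti_ne_zero hli
  rwa [← wedge_ofFn, ← List.map_ofFn, List.ofFn_get] at this

theorem coord_wedge_ofFn {n : ℕ} (v : Fin n → α →₀ F) {A : List α} (h : n = A.length) :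
    coord (wedge (List.ofFn v)) A =
      Matrix.det (Matrix.of fun i j : Fin n => v i (A.get (j.cast h))) := by
  rw [wedge_ofFn, coord_prod v A h]

theorem coord_smul_wedge (c : F) (vs : List (α →₀ F)) {A : List α} (h : vs.length = A.length) :
    coord (c • wedge vs) A =
      c * Matrix.det (Matrix.of fun i j : Fin vs.length => vs.get i (A.get (j.cast h))) := by
  rw [wedge_eq_ιMulti, ← coordLin_apply, map_smul, coordLin_apply, coord_prod _ A h, smul_eq_mul]

theorem length_of_coord_ne_zero {S : Finset α} {N : Ext F α} {c : F} {vs : List (α →₀ F)}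
    (h : IsFactorization S N c vs) {A : List α} (hA : coord N A ≠ 0) :
    vs.length = A.length := by
  by_contra hc
  apply hA
  rw [h.2, ← coordLin_apply, map_smul, coordLin_apply, coord_prod_list_ne vs (Ne.symm hc),
    smul_zero]

/-- If the coordinate at `A` is nonzero, then the members of the span of the factors are
determined by their values on `A`. -/
theorem eq_zero_of_coord_ne_zero {S : Finset α} {N : Ext F α} {c : F} {vs : List (α →₀ F)}
    (h : IsFactorization S N c vs) {A : List α} (hA : coord N A ≠ 0) {f : α →₀ F}
    (hf : f ∈ spanList vs) (hf0 : ∀ a ∈ A, f a = 0) : f = 0 := by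
  have hl := length_of_coord_ne_zero h hA
  have hN : N = c • wedge vs := h.2
  rw [hN, coord_smul_wedge c vs hl] at hA
  rw [spanList_eq, Submodule.mem_span_range_iff_exists_fun] at hf
  obtain ⟨x, rfl⟩ := hf
  -- The coefficient vector of f is annihilated by the minor matrix at A, which is nonsingular.
  have hx : x = 0 := by
    refine Matrix.eq_zero_of_vecMul_eq_zero (right_ne_zero_of_mul hA) ?_
    ext j
    have := hf0 (A.get (j.cast hl)) (List.get_mem _ _)
    simpa [Matrix.vecMul, dotProduct, Finsupp.finsetSum_apply] using this
  simp [hx]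

/-- If the members of the span of the factors are determined by their values on `B`, then some
coordinate at a sequence of elements of `B` is nonzero. -/
theorem exists_coord_ne_zero_of_spanning {S : Finset α} {N : Ext F α} {c : F}
    {vs : List (α →₀ F)} (h : IsFactorization S N c vs) (h0 : N ≠ 0) {B : Finset α}
    (hB : ∀ f ∈ spanList vs, (∀ b ∈ B, f b = 0) → f = 0) :
    ∃ A : List α, coord N A ≠ 0 ∧ A.Nodup ∧ ∀ a ∈ A, a ∈ B := by
  have hN : N = c • wedge vs := h.2
  -- The hypothesis says that restriction to B is injective on the span, so the restricted extensor
  -- is nonzero; any nonzero coordinate of it serves.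
  have hr : restrictExt (B : Set α) N = c • wedge (vs.map (restrictLin F (B : Set α))) := by
    rw [hN]
    exact restrictExt_smul_prod _ _ _
  have hc : c ≠ 0 := by
    rintro rfl
    exact h0 (by rw [hN, zero_smul])
  have hw : wedge vs ≠ 0 := fun hw => h0 (by rw [hN, hw, smul_zero])
  have hr0 : restrictExt (B : Set α) N ≠ 0 := by
    rw [hr]
    refine smul_ne_zero hc (wedge_map_ne_zero hw _ fun f hf hpf => hB f hf fun b hb => ?_)
    have := DFunLike.congr_fun hpf b
    rwa [restrictLin_apply, if_pos (by simpa using hb)] at this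
  have hmem : restrictExt (B : Set α) N ∈ groundSubmodule F B := by
    rw [hr]
    refine Submodule.smul_mem _ _ (prod_ι_mem_groundSubmodule ?_)
    intro v hv a ha
    obtain ⟨u, -, rfl⟩ := List.mem_map.1 hv
    rw [restrictLin_apply, if_neg (by simpa using ha)]
  obtain ⟨A, hA, hn, hAB⟩ := exists_coord_ne_zero hmem hr0
  exact ⟨A, by rwa [coord_restrictExt h.mem_groundSubmodule _ (by simpa using hAB)] at hA, hn, hAB⟩

/-- The factors can be chosen such that they form an identity matrix at a sequence where the
coordinate is nonzero. -/
theorem exists_reduced_factors {S : Finset α} {N : Ext F α} {c : F} {vs : List (α →₀ F)}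
    (h : IsFactorization S N c vs) {B : List α} (hB : coord N B ≠ 0) :
    ∃ u : Fin B.length → α →₀ F, (∀ i, u i ∈ spanList vs) ∧
      (∀ i j, u i (B.get j) = if i = j then 1 else 0) ∧
      N = coord N B • wedge (List.ofFn u) := by
  have hl := length_of_coord_ne_zero h hB
  have hN : N = c • wedge vs := h.2
  obtain ⟨n, v, rfl⟩ : ∃ n, ∃ v : Fin n → α →₀ F, vs = List.ofFn v :=
    ⟨_, vs.get, (List.ofFn_get vs).symm⟩
  have hl' : n = B.length := by simpa using hl
  subst hl'
  have hcoord : ∀ A : List α, ∀ hA : B.length = A.length, coord N A =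
      c * Matrix.det (Matrix.of fun i j : Fin B.length => v i (A.get (j.cast hA))) := by
    intro A hA
    rw [hN, ← coordLin_apply, map_smul, coordLin_apply, coord_wedge_ofFn v hA, smul_eq_mul]
  set M : Matrix (Fin B.length) (Fin B.length) F := Matrix.of fun i j => v i (B.get j) with hM
  have hBM : coord N B = c * M.det := hcoord B rfl
  have hdet : IsUnit M.det := (right_ne_zero_of_mul (hBM ▸ hB)).isUnit
  -- Row reduction: the factors are multiplied by the inverse of their minor matrix at B. Every
  -- minor of v is then det M times that of u, and c · det M is the coordinate at B.
  let u : Fin B.length → α →₀ F := fun i => ∑ j, M⁻¹ i j • v j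
  have hmem : ∀ i, u i ∈ spanList (List.ofFn v) := fun i =>
    Submodule.sum_mem _ fun j _ => Submodule.smul_mem _ _ (Submodule.subset_span (by simp))
  have hu : ∀ i a, u i a = ∑ j, M⁻¹ i j * v j a := fun i a => by
    simp [u, Finsupp.finsetSum_apply]
  refine ⟨u, hmem, fun i j => ?_, ?_⟩
  · have := congrFun (congrFun (Matrix.nonsing_inv_mul M hdet) i) j
    rw [Matrix.mul_apply, Matrix.one_apply] at this
    rw [hu, ← this]
    rfl
  · have hvu : ∀ i a, v i a = ∑ j, M i j * u j a := by
      intro i a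
      have h1 : ∑ j, M i j * u j a = (M * M⁻¹).mulVec (fun k => v k a) i := by
        rw [← Matrix.mulVec_mulVec]
        simp only [Matrix.mulVec, dotProduct, hu]
      rw [h1, Matrix.mul_nonsing_inv M hdet, Matrix.one_mulVec]
    refine ext_coord (S := S) h.mem_groundSubmodule (Submodule.smul_mem _ _
      (prod_ι_mem_groundSubmodule ?_)) fun A => ?_
    · intro w hw a ha
      obtain ⟨i, rfl⟩ := (List.mem_ofFn' _ _).1 hw
      exact eq_zero_of_mem_spanList h.1 (hmem i) ha
    · rw [← coordLin_apply A (_ • _), map_smul, coordLin_apply, smul_eq_mul]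
      by_cases hA : B.length = A.length
      · rw [hcoord A hA, coord_wedge_ofFn u hA, hBM, mul_assoc, ← Matrix.det_mul]
        congr 2
        ext i j
        simp only [Matrix.of_apply, Matrix.mul_apply]
        exact hvu i _
      · rw [wedge, coord_prod_list_ne _ (by simpa using Ne.symm hA), mul_zero]
        by_contra hc
        exact hA (by simpa using length_of_coord_ne_zero h hc)

/-- The entries of the reduced factors are quotients of Plücker coordinates. -/
theorem coord_set_reduced {B : List α} {u : Fin B.length → α →₀ F}
    (hu : ∀ i j, u i (B.get j) = if i = j then 1 else 0) (i : Fin B.length) (e : α) :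
    coord (wedge (List.ofFn u)) (B.set i e) = u i e := by
  rw [coord_wedge_ofFn u (by simp)]
  -- Exchanging one element of B replaces one column of the identity matrix, so Cramer's rule
  -- evaluates the minor as a single entry.
  have : (Matrix.of fun k j : Fin B.length => u k ((B.set i e).get (j.cast (by simp)))) =
      (1 : Matrix (Fin B.length) (Fin B.length) F).updateCol i fun k => u k e := by
    ext k j
    rw [Matrix.updateCol_apply, Matrix.of_apply]
    split_ifs with hj
    · subst hj
      simp
    · rw [Matrix.one_apply, ← hu k j]
      have hij : (i : ℕ) ≠ j := fun h => hj (Fin.ext h.symm)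
      simp [List.getElem_set_ne hij]
  rw [this, ← Matrix.cramer_apply, Matrix.cramer_one]
  rfl

end Span

/-! ### Presentations of oriented matroids -/

section Presentations

variable {α : Type*} {N N' : Ext ℚ α} {M : OrientedMatroid α}

theorem Presents.mem_groundSubmodule (h : Presents N M) : N ∈ groundSubmodule ℚ M.ground := by
  obtain ⟨-, c, vs, hf, -⟩ := h
  exact hf.mem_groundSubmodule

theorem Presents.isExtensor (h : Presents N M) : IsExtensor M.ground N := by
  obtain ⟨-, c, vs, hf, -⟩ := h
  exact ⟨c, vs, hf⟩

theorem Presents.exists_length (h : Presents N M) :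
    ∃ n : ℕ, ∀ A, coord N A ≠ 0 → A.length = n := by
  obtain ⟨-, c, vs, hf, -⟩ := h
  exact ⟨vs.length, fun A hA => (length_of_coord_ne_zero hf hA).symm⟩

theorem Presents.neg (h : Presents N M) : Presents (-N) M := by
  obtain ⟨h0, c, vs, hf, hc⟩ := h
  exact ⟨neg_ne_zero.2 h0, -c, vs, ⟨hf.1, by rw [hf.2, neg_smul]⟩, hc⟩

theorem IsUnimodularPresentation.neg (h : IsUnimodularPresentation N M) :
    IsUnimodularPresentation (-N) M := by
  refine ⟨h.1.neg, fun A => ?_⟩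
  rw [← coordLin_apply, map_neg, coordLin_apply]
  rcases h.2 A with h | h | h <;> simp [h]

theorem sign_fun_eq_zero {f : α →₀ ℚ} (h : (fun a => SignType.sign (f a)) = 0) : f = 0 := by
  ext a
  exact sign_eq_zero_iff.1 (congrFun h a)

theorem Presents.isSpanning_iff (h : Presents N M) {B : Finset α} (hB : B ⊆ M.ground) :
    M.IsSpanning B ↔ ∃ A : List α, coord N A ≠ 0 ∧ A.Nodup ∧ ∀ a ∈ A, a ∈ B := by
  obtain ⟨h0, c, vs, hf, hc⟩ := h
  constructor
  · intro hs
    refine exists_coord_ne_zero_of_spanning hf h0 fun f hfv hfB => ?_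
    refine sign_fun_eq_zero (hs.2 _ ?_ ?_)
    · rw [hc]
      exact ⟨f, hfv, rfl⟩
    · intro b hb
      simp [hfB b hb]
  · rintro ⟨A, hA, -, hAB⟩
    refine ⟨hB, fun X hX hX0 => ?_⟩
    rw [hc] at hX
    obtain ⟨f, hfv, rfl⟩ := hX
    have := eq_zero_of_coord_ne_zero hf hA hfv fun a ha => sign_eq_zero_iff.1 (hX0 a (hAB a ha))
    subst this
    ext a
    simp

/-- Spanning sets are those containing a sequence with nonzero coordinate; as all such sequences
have the same length, the minimal ones are exactly the sets with nonzero coordinate. -/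
theorem Presents.isBase_iff [DecidableEq α] (h : Presents N M) {B : Finset α}
    (hB : B ⊆ M.ground) : M.IsBase B ↔ coord N B.toList ≠ 0 := by
  obtain ⟨n, hn⟩ := h.exists_length
  constructor
  · intro hb
    obtain ⟨A, hA, hAn, hAB⟩ := (h.isSpanning_iff hB).1 hb.1
    have hAB' : A.toFinset ⊆ B := fun a ha => hAB a (List.mem_toFinset.1 ha)
    have hs : M.IsSpanning A.toFinset :=
      (h.isSpanning_iff (hAB'.trans hB)).2 ⟨A, hA, hAn, fun a ha => List.mem_toFinset.2 ha⟩
    have : B = A.toFinset := le_antisymm (hb.2 hs hAB') hAB'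
    rw [this, Ne, (isAlt_coord N).perm_eq_zero (toList_toFinset_perm hAn)]
    exact hA
  · intro hb
    refine ⟨(h.isSpanning_iff hB).2 ⟨B.toList, hb, B.nodup_toList, by simp⟩, fun B' hs hle => ?_⟩
    obtain ⟨A, hA, hAn, hAB⟩ := (h.isSpanning_iff hs.1).1 hs
    have h1 : A.toFinset ⊆ B' := fun a ha => hAB a (List.mem_toFinset.1 ha)
    have h2 : B.card = A.toFinset.card := by
      rw [List.toFinset_card_of_nodup hAn, hn A hA, ← hn _ hb, Finset.length_toList]
    exact (Finset.eq_of_subset_of_card_le (h1.trans hle) h2.le) ▸ h1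

/-- Where the coordinates vanish depends on M only, through its bases; so two presentations can be
normalised at a common B. -/
theorem Presents.coord_ne_zero_of (h : Presents N M) (h' : Presents N' M) {B : List α}
    (hB : coord N B ≠ 0) : coord N' B ≠ 0 := by
  classical
  have hBn : B.Nodup := by
    by_contra hc
    exact hB ((isAlt_coord N).eq_zero hc)
  have hBS : B.toFinset ⊆ M.ground := by
    intro a ha
    by_contra hc
    exact hB (coord_eq_zero_of_notMem h.mem_groundSubmodule (List.mem_toFinset.1 ha) hc)
  have hp := toList_toFinset_perm hBn
  have h1 : coord N B.toFinset.toList ≠ 0 := by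
    rwa [Ne, (isAlt_coord N).perm_eq_zero hp]
  have h2 := (h'.isBase_iff hBS).1 ((h.isBase_iff hBS).2 h1)
  rwa [Ne, (isAlt_coord N').perm_eq_zero hp] at h2

/-- A unimodular presentation is unique up to the sign. -/
theorem IsUnimodularPresentation.eq_or_eq_neg (h : IsUnimodularPresentation N M)
    (h' : IsUnimodularPresentation N' M) : N' = N ∨ N' = -N := by
  obtain ⟨B, hB, -, -⟩ := exists_coord_ne_zero h.1.mem_groundSubmodule h.1.1
  have hB' := h.1.coord_ne_zero_of h'.1 hB
  obtain ⟨⟨-, c, vs, hf, hc⟩, hu⟩ := h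
  obtain ⟨⟨-, c', vs', hf', hc'⟩, hu'⟩ := h'
  obtain ⟨u, hmem, hδ, hN⟩ := exists_reduced_factors hf hB
  obtain ⟨u', hmem', hδ', hN'⟩ := exists_reduced_factors hf' hB'
  -- The entry of u is N[B'] / N[B] for a sequence B' differing from B in one place.
  have hval : ∀ {N : Ext ℚ α} {u : Fin B.length → α →₀ ℚ}, coord N B ≠ 0 →
      (∀ A : List α, coord N A = 0 ∨ coord N A = 1 ∨ coord N A = -1) →
      (∀ i j, u i (B.get j) = if i = j then 1 else 0) →
      N = coord N B • wedge (List.ofFn u) → ∀ i a, u i a = 0 ∨ u i a = 1 ∨ u i a = -1 := by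
    intro N u hB hu hδ hN i a
    have h1 : coord N (B.set i a) = coord N B * u i a := by
      conv_lhs => rw [hN, ← coordLin_apply, map_smul, coordLin_apply, coord_set_reduced hδ]
      rfl
    rcases (hu B).resolve_left hB with h2 | h2 <;> rw [h2] at h1 <;>
      rcases hu (B.set i a) with h3 | h3 | h3 <;> rw [h3] at h1
    · left; linarith
    · right; left; linarith
    · right; right; linarith
    · left; linarith
    · right; right; linarith
    · right; left; linarith
  have hsign : ∀ x y : ℚ, (x = 0 ∨ x = 1 ∨ x = -1) → (y = 0 ∨ y = 1 ∨ y = -1) →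
      SignType.sign x = SignType.sign y → x = y := by
    rintro x y (rfl | rfl | rfl) (rfl | rfl | rfl) <;> simp
  have huu : u = u' := by
    funext i
    have hX : (fun a => SignType.sign (u i a)) ∈ M.covectors := by
      rw [hc]
      exact ⟨u i, hmem i, rfl⟩
    rw [hc'] at hX
    obtain ⟨f, hfv, hfX⟩ := hX
    have hfX' : ∀ a, SignType.sign (u i a) = SignType.sign (f a) := fun a => congrFun hfX a
    have hfi : 0 < f (B.get i) := by
      have := hfX' (B.get i)
      rw [hδ, if_pos rfl, sign_one] at this
      exact sign_eq_one_iff.1 this.symm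
    -- The covector of u i is also the signature of some f in the second span. This f vanishes on B
    -- except at the i-th place, where it is positive, so it is a positive multiple of u' i.
    have hfu : f = f (B.get i) • u' i := by
      rw [← sub_eq_zero]
      refine eq_zero_of_coord_ne_zero hf' hB' (Submodule.sub_mem _ hfv
        (Submodule.smul_mem _ _ (hmem' i))) fun b hb => ?_
      obtain ⟨j, rfl⟩ := List.get_of_mem hb
      rw [Finsupp.sub_apply, Finsupp.smul_apply, hδ']
      split_ifs with hij
      · subst hij
        simp
      · have := hfX' (B.get j)
        rw [hδ, if_neg hij, sign_zero] at this
        rw [sign_eq_zero_iff.1 this.symm]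
        simp
    ext a
    refine hsign _ _ (hval hB hu hδ hN i a) (hval hB' hu' hδ' hN' i a) ?_
    rw [hfX' a, hfu, Finsupp.smul_apply, smul_eq_mul, sign_mul, sign_pos hfi, one_mul]
  rw [hN, hN', huu]
  rcases (hu B).resolve_left hB with h1 | h1 <;> rcases (hu' B).resolve_left hB' with h2 | h2 <;>
    simp [h1, h2]

end Presentations

/-! ### Minors and direct sums of unimodular oriented matroids -/

section Minors

variable {α : Type*} {N : Ext ℚ α} {M : OrientedMatroid α} {e : α}

theorem exists_of_not_isLoop (he : e ∈ M.ground) (hl : ¬ M.IsLoop e) :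
    ∃ X ∈ M.covectors, X e ≠ 0 := by
  by_contra! hc
  exact hl ⟨he, hc⟩

theorem coord_restrictExt_compl (hN : N ∈ groundSubmodule ℚ M.ground) {A : List α} (h : e ∉ A) :
    coord (restrictExt {e}ᶜ N) A = coord N A :=
  coord_restrictExt hN _ fun a ha hae => h (by rwa [← (show a = e from hae)])

variable [DecidableEq α]

theorem sign_restrictLin (f : α →₀ ℚ) (e : α) :
    (fun a => SignType.sign (restrictLin ℚ {e}ᶜ f a)) =
      Function.update (fun a => SignType.sign (f a)) e 0 := by
  funext a
  rw [restrictLin_apply]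
  by_cases hae : a = e
  · subst hae
    simp
  · simp [hae]

/-- The contraction of a unimodular presentation by an element that is not a loop. -/
theorem IsUnimodularPresentation.contract (h : IsUnimodularPresentation N M)
    (he : e ∈ M.ground) (hl : ¬ M.IsLoop e) :
    IsUnimodularPresentation (contract N e) (M.contract e) := by
  obtain ⟨⟨h0, c, vs, hf, hc⟩, hu⟩ := h
  have hN : N = c • wedge vs := hf.2
  have hc0 : c ≠ 0 := by
    rintro rfl
    exact h0 (by rw [hN, zero_smul])
  have hw0 : wedge vs ≠ 0 := fun hw => h0 (by rw [hN, hw, smul_zero])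
  -- If all factors vanished at e, so would every covector, and e would be a loop.
  obtain ⟨w, hw, hwe⟩ : ∃ w ∈ vs, w e ≠ 0 := by
    by_contra! hv
    obtain ⟨X, hX, hXe⟩ := exists_of_not_isLoop he hl
    rw [hc] at hX
    obtain ⟨f, hfv, rfl⟩ := hX
    refine hXe (sign_eq_zero_iff.2 ?_)
    exact (Submodule.span_le.2 hv : spanList vs ≤ LinearMap.ker (Finsupp.lapply e)) hfv
  obtain ⟨k, hk, us, hcon, hus0, hus⟩ :=
    exists_contractDual_wedge (d := Finsupp.lapply e) hw hwe
  have hcN : PortedTutte.contract N e = (c * k) • wedge us := by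
    rw [hN, ← contractLin_apply, map_smul, mul_smul, ← hcon]
    rfl
  refine ⟨⟨?_, c * k, us, ⟨fun v hv a ha => ?_, hcN⟩, ?_⟩, fun A => ?_⟩
  · rw [hcN]
    exact smul_ne_zero (mul_ne_zero hc0 hk) (hus0 hw0)
  · have hv' := (hus v).1 (Submodule.subset_span hv)
    by_cases hae : a = e
    · subst hae
      exact hv'.2
    · exact eq_zero_of_mem_spanList hf.1 hv'.1 fun h => ha (Finset.mem_erase.2 ⟨hae, h⟩)
  · ext X
    simp only [OrientedMatroid.contract, hc, Set.mem_ofPred_eq]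
    constructor
    · rintro ⟨⟨f, hfv, rfl⟩, hXe⟩
      exact ⟨f, (hus f).2 ⟨hfv, sign_eq_zero_iff.1 hXe⟩, rfl⟩
    · rintro ⟨f, hfu, rfl⟩
      have := (hus f).1 hfu
      exact ⟨⟨f, this.1, rfl⟩, sign_eq_zero_iff.2 this.2⟩
  · rw [coord_contract]
    exact hu _

/-- The deletion from a unimodular presentation of an element that is not a coloop. -/
theorem IsUnimodularPresentation.delete (h : IsUnimodularPresentation N M)
    (he : e ∈ M.ground) (hl : ¬ M.IsColoop e) :
    IsUnimodularPresentation (restrictExt {e}ᶜ N) (M.delete e) := by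
  have hNg := h.1.mem_groundSubmodule
  obtain ⟨⟨h0, c, vs, hf, hc⟩, hu⟩ := h
  have hN : N = c • wedge vs := hf.2
  have hc0 : c ≠ 0 := by
    rintro rfl
    exact h0 (by rw [hN, zero_smul])
  have hw0 : wedge vs ≠ 0 := fun hw => h0 (by rw [hN, hw, smul_zero])
  have hrN : restrictExt {e}ᶜ N = c • wedge (vs.map (restrictLin ℚ {e}ᶜ)) := by
    rw [hN]
    exact restrictExt_smul_prod _ _ _
  have hfac : IsFactorization (M.delete e).ground (restrictExt {e}ᶜ N) c
      (vs.map (restrictLin ℚ {e}ᶜ)) := by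
    refine ⟨fun v hv a ha => ?_, hrN⟩
    obtain ⟨w, hw, rfl⟩ := List.mem_map.1 hv
    rw [restrictLin_apply]
    split_ifs with hae
    · exact hf.1 w hw a fun h => ha (Finset.mem_erase.2 ⟨hae, h⟩)
    · rfl
  refine ⟨⟨?_, c, _, hfac, ?_⟩, fun A => ?_⟩
  · rw [hrN]
    refine smul_ne_zero hc0 (wedge_map_ne_zero hw0 _ fun f hfv hpf => ?_)
    -- A nonzero member of the span killed by the restriction has support {e}; its signature would
    -- make e a coloop.
    by_contra hf0
    have hfa : ∀ a, a ≠ e → f a = 0 := by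
      intro a hae
      have := DFunLike.congr_fun hpf a
      rwa [restrictLin_apply, if_pos (by simpa using hae)] at this
    refine hl ⟨he, fun a => SignType.sign (f a), ?_, fun a => ?_⟩
    · rw [hc]
      exact ⟨f, hfv, rfl⟩
    · rw [Ne, sign_eq_zero_iff]
      refine ⟨fun h => by_contra fun hae => h (hfa a hae), ?_⟩
      rintro rfl hfa0
      apply hf0
      ext b
      by_cases hb : b = a
      · rw [hb, hfa0]
        rfl
      · rw [hfa b hb]
        rfl
  · have hspan : spanList (vs.map (restrictLin ℚ {e}ᶜ)) =
        (spanList vs).map (restrictLin ℚ {e}ᶜ) := by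
      rw [spanList, spanList, Submodule.map_span]
      congr 1
      ext v
      simp
    ext X
    change (∃ Y ∈ M.covectors, X = Function.update Y e 0) ↔
      ∃ f ∈ spanList (vs.map (restrictLin ℚ {e}ᶜ)), X = fun a => SignType.sign (f a)
    rw [hspan, hc]
    constructor
    · rintro ⟨_, ⟨f, hfv, rfl⟩, rfl⟩
      exact ⟨_, ⟨f, hfv, rfl⟩, (sign_restrictLin f e).symm⟩
    · rintro ⟨_, ⟨f, hfv, rfl⟩, rfl⟩
      exact ⟨_, ⟨f, hfv, rfl⟩, sign_restrictLin f e⟩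
  · by_cases heA : e ∈ A
    · left
      exact coord_eq_zero_of_notMem hfac.mem_groundSubmodule heA (Finset.notMem_erase _ _)
    · rw [coord_restrictExt_compl hNg heA]
      exact hu A

/-- A unimodular presentation presents both minors at a loop. -/
theorem IsUnimodularPresentation.of_isLoop (h : IsUnimodularPresentation N M)
    (hl : M.IsLoop e) :
    IsUnimodularPresentation N (M.contract e) ∧ IsUnimodularPresentation N (M.delete e) := by
  obtain ⟨⟨h0, c, vs, hf, hc⟩, hu⟩ := h
  have hfac : IsFactorization (M.ground.erase e) N c vs := by
    refine ⟨fun v hv a ha => ?_, hf.2⟩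
    by_cases hae : a = e
    · subst hae
      refine sign_eq_zero_iff.1 (hl.2 (fun b => SignType.sign (v b)) ?_)
      rw [hc]
      exact ⟨v, Submodule.subset_span hv, rfl⟩
    · exact hf.1 v hv a fun h => ha (Finset.mem_erase.2 ⟨hae, h⟩)
  refine ⟨⟨⟨h0, c, vs, hfac, ?_⟩, hu⟩, ⟨⟨h0, c, vs, hfac, ?_⟩, hu⟩⟩
  · rw [← hc]
    ext X
    exact ⟨fun h => h.1, fun h => ⟨h, hl.2 X h⟩⟩
  · rw [← hc]
    ext X
    have hupd : ∀ Y ∈ M.covectors, Function.update Y e 0 = Y := fun Y hY => by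
      rw [← hl.2 Y hY, Function.update_eq_self]
    constructor
    · rintro ⟨Y, hY, rfl⟩
      rwa [hupd Y hY]
    · exact fun h => ⟨X, h, (hupd X h).symm⟩

/-- A covector supported on {e}, with the sign opposite to Y at e, eliminates e from Y without
changing any other entry; thus the restriction of Y off e is itself a covector of M. This covers the
deletion of a coloop, where restricting the extensor would fail. -/
theorem delete_eq_contract_of_isColoop (hl : M.IsColoop e) : M.delete e = M.contract e := by
  obtain ⟨C, hC, hCs⟩ := hl.2
  have hCa : ∀ a, a ≠ e → C a = 0 := fun a ha => by
    by_contra h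
    exact ha ((hCs a).1 h)
  refine OrientedMatroid.ext rfl ?_
  ext X
  change (∃ Y ∈ M.covectors, X = Function.update Y e 0) ↔ X ∈ M.covectors ∧ X e = 0
  constructor
  · rintro ⟨Y, hY, rfl⟩
    refine ⟨?_, by simp⟩
    by_cases hYe : Y e = 0
    · rwa [← hYe, Function.update_eq_self]
    · have hCe : C e ≠ 0 := (hCs e).2 rfl
      -- D is C or -C, whichever is opposite to Y at e.
      obtain ⟨D, hD, hDa, hDe⟩ : ∃ D ∈ M.covectors, (∀ a, a ≠ e → D a = 0) ∧ Y e = -D e := by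
        by_cases h1 : Y e = -C e
        · exact ⟨C, hC, hCa, h1⟩
        · refine ⟨-C, M.neg_mem C hC, fun a ha => by simp [hCa a ha], ?_⟩
          rw [Pi.neg_apply]
          revert hYe hCe h1
          generalize Y e = y
          generalize C e = c
          revert y c
          decide
      obtain ⟨Z, hZ, hZe, hZa⟩ := M.elim Y hY D hD e hYe hDe
      have : Function.update Y e 0 = Z := by
        funext a
        by_cases hae : a = e
        · subst hae
          simp [hZe]
        · rw [Function.update_of_ne hae, hZa a (by simp [hDa a hae]), comp, hDa a hae]
          split_ifs with h
          · exact h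
          · rfl
      rwa [this]
  · rintro ⟨hX, hXe⟩
    exact ⟨X, hX, by rw [← hXe, Function.update_eq_self]⟩

/-- Minors of unimodular oriented matroids are unimodular. -/
theorem IsUnimodular.minors (h : IsUnimodular M) (he : e ∈ M.ground) :
    IsUnimodular (M.contract e) ∧ IsUnimodular (M.delete e) := by
  obtain ⟨N, hN⟩ := h
  by_cases hl : M.IsLoop e
  · exact ⟨⟨N, (hN.of_isLoop hl).1⟩, ⟨N, (hN.of_isLoop hl).2⟩⟩
  · have hcon : IsUnimodular (M.contract e) := ⟨_, hN.contract he hl⟩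
    refine ⟨hcon, ?_⟩
    by_cases hl' : M.IsColoop e
    · rwa [delete_eq_contract_of_isColoop hl']
    · exact ⟨_, hN.delete he hl'⟩

theorem IsUnimodularPresentation.directSum {N₁ N₂ : Ext ℚ α} {M₁ M₂ : OrientedMatroid α}
    (hd : Disjoint M₁.ground M₂.ground) (h₁ : IsUnimodularPresentation N₁ M₁)
    (h₂ : IsUnimodularPresentation N₂ M₂) :
    IsUnimodularPresentation (N₁ * N₂) (M₁.directSum M₂ hd) := by
  have hg₁ := h₁.1.mem_groundSubmodule
  have hg₂ := h₂.1.mem_groundSubmodule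
  obtain ⟨A₁, hA₁, -, hAS₁⟩ := exists_coord_ne_zero hg₁ h₁.1.1
  obtain ⟨A₂, hA₂, -, hAS₂⟩ := exists_coord_ne_zero hg₂ h₂.1.1
  obtain ⟨⟨-, c₁, vs₁, hf₁, hc₁⟩, hu₁⟩ := h₁
  obtain ⟨⟨-, c₂, vs₂, hf₂, hc₂⟩, hu₂⟩ := h₂
  have hdis := Finset.disjoint_left.1 hd
  refine ⟨⟨?_, _, _, hf₁.mul hf₂, ?_⟩, fun A => ?_⟩
  · intro h0
    have := coord_mul hd hg₁ hg₂ hAS₁ hAS₂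
    rw [h0, ← coordLin_apply, map_zero] at this
    exact mul_ne_zero hA₁ hA₂ this.symm
  · have hspan : spanList (vs₁ ++ vs₂) = spanList vs₁ ⊔ spanList vs₂ := by
      rw [spanList, spanList, spanList, ← Submodule.span_union]
      congr 1
      ext v
      simp
    -- Members of the two spans have disjoint supports, so composing their signatures amounts to
    -- adding the vectors.
    have hsign : ∀ f₁ ∈ spanList vs₁, ∀ f₂ ∈ spanList vs₂,
        comp (fun a => SignType.sign (f₁ a)) (fun a => SignType.sign (f₂ a)) =
          fun a => SignType.sign ((f₁ + f₂) a) := by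
      intro f₁ hf f₂ hf'
      funext a
      by_cases ha : a ∈ M₁.ground
      · have := eq_zero_of_mem_spanList hf₂.1 hf' (hdis ha)
        simp +contextual [comp, this]
      · have := eq_zero_of_mem_spanList hf₁.1 hf ha
        simp [comp, this]
    ext X
    change (∃ X₁ ∈ M₁.covectors, ∃ X₂ ∈ M₂.covectors, X = comp X₁ X₂) ↔
      ∃ f ∈ spanList (vs₁ ++ vs₂), X = fun a => SignType.sign (f a)
    rw [hspan, hc₁, hc₂]
    constructor
    · rintro ⟨_, ⟨f₁, hf, rfl⟩, _, ⟨f₂, hf', rfl⟩, rfl⟩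
      exact ⟨f₁ + f₂, Submodule.add_mem_sup hf hf', hsign f₁ hf f₂ hf'⟩
    · rintro ⟨f, hf, rfl⟩
      obtain ⟨f₁, h₁, f₂, h₂, rfl⟩ := Submodule.mem_sup.1 hf
      exact ⟨_, ⟨f₁, h₁, rfl⟩, _, ⟨f₂, h₂, rfl⟩, (hsign f₁ h₁ f₂ h₂).symm⟩
  · set B := A.filter (· ∈ M₁.ground)
    set B' := A.filter (· ∉ M₁.ground) with hB'
    -- Sorting A by ground set costs only a sign; the coordinate is then a product of coordinates of
    -- the factors, or zero if A leaves the ground set.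
    have hp : A.Perm (B ++ B') := by
      have := List.filter_append_perm (fun a => decide (a ∈ M₁.ground)) A
      simpa [B, B'] using this.symm
    have hval : coord (N₁ * N₂) (B ++ B') = 0 ∨ coord (N₁ * N₂) (B ++ B') = 1 ∨
        coord (N₁ * N₂) (B ++ B') = -1 := by
      by_cases hS : ∀ a ∈ B', a ∈ M₂.ground
      · rw [coord_mul hd hg₁ hg₂ (by simp [B]) hS]
        rcases hu₁ B with h | h | h <;> rcases hu₂ B' with h' | h' | h' <;> simp [h, h']
      · push Not at hS
        obtain ⟨a, ha, haS⟩ := hS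
        left
        refine coord_eq_zero_of_notMem (hf₁.mul hf₂).mem_groundSubmodule
          (List.mem_append_right _ ha) ?_
        have : a ∉ M₁.ground := by simpa using (List.mem_filter.1 ha).2
        simp [this, haS]
    rcases (isAlt_coord (N₁ * N₂)).perm hp with h | h <;> rw [h] <;>
      rcases hval with h' | h' | h' <;> simp [h']

end Minors

/-! ### The function `M_E` on unimodular oriented matroids -/

section Values

variable {α : Type*} [DecidableEq α] {K : Type*} [Field K] [CharZero K]
  (ε : GroundSetOrientation α) (g r : α → K)

theorem matME_eq_extME {N : Ext ℚ α} {M : OrientedMatroid α} (P E : List α)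
    (h : IsUnimodularPresentation N M) : matME ε g r P E M = extME ε g r P E N := by
  have hM : IsUnimodular M := ⟨N, h⟩
  rw [matME, dif_pos hM]
  rcases h.eq_or_eq_neg hM.choose_spec with h' | h' <;> rw [h']
  exact extME_neg ε g r P E N

end Values

end PortedTutte

end

open PortedTutte in
theorem mainTheorem3 {α : Type*} [DecidableEq α] {K : Type*} [Field K] [CharZero K]
    (ε : GroundSetOrientation α) (g r : α → K) :
    -- `M_E` is well defined, with extensor values, on the minor-closed class of ported
    -- unimodular oriented matroids
    (∀ (M : OrientedMatroid α) (P E : List α), IsPorted M P E → IsUnimodular M →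
      (∃ N : Ext ℚ α, ∀ N' : Ext ℚ α,
        IsUnimodularPresentation N' M ↔ N' = N ∨ N' = -N) ∧
      (∀ N : Ext ℚ α, IsUnimodularPresentation N M →
        matME ε g r P E M = extME ε g r P E N) ∧
      IsExtensor (portCopies P) (matME ε g r P E M) ∧
      (∀ e ∈ M.ground, IsUnimodular (M.contract e) ∧ IsUnimodular (M.delete e))) ∧
    -- the additive equation
    (∀ (M : OrientedMatroid α) (P E E' : List α) (e : α), IsPorted M P E → IsUnimodular M →
      E.Perm (e :: E') → ¬ M.IsSeparator e →
      matME ε g r P E M =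
        ((ε.sgn (P ++ E) * ε.sgn (P ++ E') : ℤ) : K) •
          (g e • matME ε g r P E' (M.contract e) + r e • matME ε g r P E' (M.delete e))) ∧
    -- the multiplicative equation
    (∀ (M₁ M₂ : OrientedMatroid α) (P₁ E₁ P₂ E₂ E : List α)
      (hd : Disjoint M₁.ground M₂.ground),
      IsPorted M₁ P₁ E₁ → IsPorted M₂ P₂ E₂ → IsUnimodular M₁ → IsUnimodular M₂ →
      E.Perm (E₁ ++ E₂) →
      IsUnimodular (M₁.directSum M₂ hd) ∧
      matME ε g r (P₁ ++ P₂) E (M₁.directSum M₂ hd) =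
        ((ε.sgn (P₁ ++ P₂ ++ E) * ε.sgn (P₁ ++ E₁) * ε.sgn (P₂ ++ E₂) : ℤ) : K) •
          (matME ε g r P₁ E₁ M₁ * matME ε g r P₂ E₂ M₂)) ∧
    -- the case without ports
    (∀ (M : OrientedMatroid α) (E : List α), IsPorted M [] E → IsUnimodular M →
      matME ε g r [] E M =
        algebraMap K (Ext K (PortedElt α))
          ((ε.sgn E : K) *
            ∑ B ∈ M.bases, (∏ e ∈ B, g e) * ∏ e ∈ M.ground \ B, r e)) := by
  refine ⟨?_, ?_, ?_, ?_⟩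
  · intro M P E hPE ⟨N, hN⟩
    refine ⟨⟨N, fun N' => ⟨fun h => hN.eq_or_eq_neg h, ?_⟩⟩,
      fun N' h => matME_eq_extME ε g r P E h, ?_, fun e he => IsUnimodular.minors ⟨N, hN⟩ he⟩
    · rintro (rfl | rfl)
      · exact hN
      · exact hN.neg
    · rw [matME_eq_extME ε g r P E hN]
      exact IsExtensor.extME ε g r (hPE.2 ▸ hN.1.isExtensor)
  · intro M P E E' e ⟨hn, hg⟩ ⟨N, hN⟩ hE hs
    have he : e ∈ M.ground := by
      rw [hg, List.mem_toFinset, List.mem_append]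
      exact .inr (hE.mem_iff.2 (by simp))
    have hn' : (P ++ e :: E').Nodup := (hE.append_left P).nodup_iff.1 hn
    have hg' : M.ground.erase e = (P ++ E').toFinset := by
      have hnot : e ∉ P ++ E' := (List.nodup_middle.1 hn').notMem
      rw [hg, List.toFinset_eq_of_perm _ _ ((hE.append_left P).trans List.perm_middle),
        List.toFinset_cons, Finset.erase_insert (by simpa using hnot)]
    have hl : ¬ M.IsLoop e := fun h => hs (.inl h)
    have hl' : ¬ M.IsColoop e := fun h => hs (.inr h)
    have h₁ := hN.contract he hl
    have h₂ := hN.delete he hl'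
    rw [matME_eq_extME ε g r P E hN, matME_eq_extME ε g r P E' h₁, matME_eq_extME ε g r P E' h₂]
    have hg₁ := h₁.1.mem_groundSubmodule
    have hg₂ := h₂.1.mem_groundSubmodule
    change _ ∈ groundSubmodule ℚ (M.ground.erase e) at hg₁ hg₂
    rw [hg'] at hg₁ hg₂
    exact extME_add ε g r hn hE (hg ▸ hN.1.mem_groundSubmodule) hg₁ hg₂
      (fun A => coord_contract N e A)
      (fun A hA => coord_restrictExt_compl hN.1.mem_groundSubmodule hA)
  · intro M₁ M₂ P₁ E₁ P₂ E₂ E hd ⟨hn₁, hg₁⟩ ⟨hn₂, hg₂⟩ ⟨N₁, hN₁⟩ ⟨N₂, hN₂⟩ hE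
    have hN := hN₁.directSum hd hN₂
    -- The common length of the nonzero coordinates of N₂ drives the cancellation of signs in
    -- `extME_mul`.
    obtain ⟨n, hn⟩ := hN₂.1.exists_length
    refine ⟨⟨_, hN⟩, ?_⟩
    rw [matME_eq_extME ε g r _ E hN, matME_eq_extME ε g r P₁ E₁ hN₁,
      matME_eq_extME ε g r P₂ E₂ hN₂]
    refine extME_mul ε g r hn₁ hn₂ (hg₁ ▸ hg₂ ▸ hd) hE (hg₁ ▸ hN₁.1.mem_groundSubmodule)
      (hg₂ ▸ hN₂.1.mem_groundSubmodule) ?_ hn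
    have h := hN.1.mem_groundSubmodule
    change _ ∈ groundSubmodule ℚ (M₁.ground ∪ M₂.ground) at h
    convert h using 2
    rw [hg₁, hg₂]
    ext a
    simp only [List.toFinset_append, Finset.mem_union, List.mem_toFinset, hE.mem_iff,
      List.mem_append]
    tauto
  · intro M E ⟨hn, hg⟩ ⟨N, hN⟩
    rw [List.nil_append] at hn hg
    rw [matME_eq_extME ε g r [] E hN, extME_nil ε g r hn (hg ▸ hN.1.mem_groundSubmodule)]
    congr 2
    rw [OrientedMatroid.bases, Finset.sum_filter, hg]
    refine Finset.sum_congr rfl fun B hB => ?_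
    have hB' : B ⊆ M.ground := hg ▸ Finset.mem_powerset.1 hB
    have hb := hN.1.isBase_iff hB'
    -- At a base the coordinate is ±1 and its square is 1; at any other subset it is 0. So the sum
    -- over all subsets becomes the sum over the bases.
    split_ifs with h
    · rcases (hN.2 B.toList).resolve_left (hb.1 h) with h1 | h1 <;> simp [h1]
    · rw [hb, not_not] at h
      simp [h]
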